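/- Let $p$ be a prime and $n$ a positive integer. For each positive integer $k$ let $\mathbb F_{p^k}$ be a field with $p^k$ elements. For each positive integer $k$ with $p^k\equiv 1\pmod 3$, put $q=p^k$ and let $T_k$ be the number of $a\in\mathbb F_q$ for which $x^n(x^{\frac{q-1}{3}}+a)$ is a permutation polynomial over $\mathbb F_q$, i.e. induces a bijection $\mathbb F_q\to\mathbb F_q$. Call $k$ *admissible* if $p^k\equiv 1\pmod 3$ and $\gcd\left(n,\frac{p^k-1}{3}\right)=1$. (1) For every admissible $k$, with $q=p^k$, $$\left\lceil\frac{2q-4\sqrt q-16}{9}\right\rceil\le T_k\le\left\lfloor\frac{2q+4\sqrt q-7}{9}\right\rfloor .$$ (2) These bounds are asymptotically sharp. Suppose that at least one admissible $k$ exists. Then for every $\varepsilon>0$: - there are infinitely many admissible $k'$ with $T_{k'}>\frac29p^{k'}+\left(\frac49-\varepsilon\right)\sqrt{p^{k'}}$; - there are infinitely many $k$ with $p^k\equiv1\pmod 3$ and $T_k<\frac29p^{k}-\left(\frac49-\varepsilon\right)\sqrt{p^{k}}$; - if $p\equiv 1\pmod 3$, or if some admissible integer is divisible by $4$, then there are infinitely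 many admissible $k$ with $T_k<\frac29p^{k}-\left(\frac49-\varepsilon\right)\sqrt{p^{k}}$. (3) Put $M_r=r^{r+1}-2r^r-r^{r-1}+2$, so that $M_3=20$. The Masuda–Zieve estimate $$\frac{r!}{r^r}\left(q+1-\sqrt q\,M_r-(r+1)r^{r-1}\right)\le T\le\frac{r!}{r^r}\left(q+1+\sqrt q\,M_r\right)$$ for $r=3$ and $T=T_k$ holds with $M_3=20$ replaced by $2$: for every admissible $k$, with $q=p^k$, $$\frac29\left(q+1-2\sqrt q-36\right)\le T_k\le\frac29\left(q+1+2\sqrt q\right).$$ -/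

import Mathlib

/-- `f` is a permutation polynomial over `F`: the map `c ↦ f(c)` permutes the elements of `F`. -/
def IsPermutationPolynomial {F : Type*} [Field F] (f : Polynomial F) : Prop :=
  Function.Bijective (fun c : F => f.eval c)

/-- The binomial `x ^ n * (x ^ ((q - 1) / 3) + a)` over the field `F` with `q` elements. -/
noncomputable def cubicBinomial (F : Type*) [Field F] (n : ℕ) (a : F) : Polynomial F :=
  Polynomial.X ^ n * (Polynomial.X ^ ((Nat.card F - 1) / 3) + Polynomial.C a)

/-- The number of `a ∈ F` for which `x ^ n * (x ^ ((q - 1) / 3) + a)` permutes `F`. -/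
noncomputable def permBinomialCount (F : Type*) [Field F] (n : ℕ) : ℕ :=
  Set.ncard {a : F | IsPermutationPolynomial (cubicBinomial F n a)}

/-- The assumptions linking `p`, `n` and `k`: with `q = p ^ k`, `k` positive, one has
`q ≡ 1 (mod 3)` and `gcd (n, (q - 1) / 3) = 1`. -/
def Admissible (p n k : ℕ) : Prop :=
  0 < k ∧ p ^ k ≡ 1 [MOD 3] ∧ Nat.gcd n ((p ^ k - 1) / 3) = 1

/-- The Masuda-Zieve constant `M_r = r ^ (r + 1) - 2 r ^ r - r ^ (r - 1) + 2` (for `r ≥ 1`). -/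
def masudaZieveConst (r : ℕ) : ℤ :=
  (r : ℤ) ^ (r + 1) - 2 * (r : ℤ) ^ r - (r : ℤ) ^ (r - 1) + 2

/-- The two-sided Masuda-Zieve estimate for a count `T` over a field with `q` elements,
with the constant `M` in front of `√q`. -/
def MasudaZieveEstimate (r q : ℕ) (M : ℝ) (T : ℕ) : Prop :=
  ((r.factorial : ℝ) / (r : ℝ) ^ r) *
      ((q : ℝ) + 1 - √(q : ℝ) * M - ((r : ℝ) + 1) * (r : ℝ) ^ (r - 1)) ≤ (T : ℝ) ∧
  (T : ℝ) ≤ ((r.factorial : ℝ) / (r : ℝ) ^ r) * ((q : ℝ) + 1 + √(q : ℝ) * M)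

/-! Write q = 3s + 1. On each coset of the nonzero cubes x^s is constant, so x^n (x^s + a) acts
there as a multiple of x^n. It permutes the field exactly when gcd(n, s) = 1 and the values of a
cubic character χ on the images of the three cosets are nonzero and distinct
(`separated_of_bijective`, `bijective_of_separated`, `gcd_eq_one_of_injective`). A polynomial in
these values detects this, and summing it over a gives 9T = 2q + 2t - 7 or 2q + 2t - 16, with t =
J(χ,χ) + J(χ⁻¹,χ⁻¹) (`nine_mul_permBinomialCount`). Since 4q = t² + 27b², |t| ≤ 2√q, and the bounds
follow.

Sharpness asks for t/√q near 2 and -2. If p ≡ 2 (mod 3), the norm equation forces t = -2(-p)^m for q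
= p^(2m). If p ≡ 1 (mod 3), p does not divide t, because t is minus a binomial coefficient mod p
(`trace_cast`). Hence 4q = t² + 27b² determines t up to sign and t ≡ 1 (mod 3) fixes the sign, so
the traces over the extensions are a Lucas sequence up to sign; this replaces the Hasse–Davenport
relation. Its normalized terms are 2cos(kθ) with θ/π irrational, and density of powers on the circle
applies. Admissibility persists from k to k(1 + φ(3n)j), which is compatible with both arguments. -/

/-- `χ` is a cubic character of the finite field `F` with `3 * s + 1` elements,
and `g` is a primitive root of `F`. -/
structure IsCubicCharacter {F : Type*} [Field F] [Fintype F] (s : ℕ) (χ : MulChar F ℂ) (g : F) :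
    Prop where
  card : Fintype.card F = 3 * s + 1
  isPrimitiveRoot_apply : IsPrimitiveRoot (χ g) 3
  pow_three : χ ^ 3 = 1
  isPrimitiveRoot : IsPrimitiveRoot g (3 * s)
  exists_pow : ∀ x : F, x ≠ 0 → ∃ m : ℕ, x = g ^ m

/-! ### Cubic characters, cube roots and elementary character sums. -/

theorem exists_isCubicCharacter (F : Type*) [Field F] [Fintype F] {s : ℕ}
    (hs : Fintype.card F = 3 * s + 1) :
    ∃ (χ : MulChar F ℂ) (g : F), IsCubicCharacter s χ g := by
  classical
  obtain ⟨ζ, hζ⟩ : ∃ ζ : ℂ, IsPrimitiveRoot ζ 3 := ⟨_, Complex.isPrimitiveRoot_exp 3 (by norm_num)⟩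
  obtain ⟨χ, hχ⟩ := MulChar.exists_mulChar_orderOf F (n := 3) (by rw [hs]; simp) hζ
  obtain ⟨g, hg⟩ := IsCyclic.exists_generator (α := Fˣ)
  have hc : χ ^ 3 = 1 := by rw [← hχ]; exact pow_orderOf_eq_one χ
  have hcard : orderOf g = 3 * s := by
    rw [orderOf_eq_card_of_forall_mem_zpowers hg, Nat.card_eq_fintype_card, Fintype.card_units, hs]
    simp
  refine ⟨χ, g, hs, ?_, hc, ?_, ?_⟩
  · have h3 : χ (g : F) ^ 3 = 1 := by
      rw [← MulChar.pow_apply_coe, hc, MulChar.one_apply_coe]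
    have h1 : χ (g : F) ≠ 1 := by
      intro h
      have : χ = 1 := by
        rw [MulChar.eq_iff hg, h, MulChar.one_apply_coe]
      rw [this, orderOf_one] at hχ
      omega
    exact IsPrimitiveRoot.iff_orderOf.2 (orderOf_eq_prime h3 h1)
  · rw [← hcard]
    exact IsPrimitiveRoot.coe_units_iff.2 (IsPrimitiveRoot.orderOf g)
  · intro x hx
    obtain ⟨m, hm⟩ := (mem_powers_iff_mem_zpowers (x := g)).2 (hg (Units.mk0 x hx))
    exact ⟨m, by have := congrArg Units.val hm; simpa using this.symm⟩

namespace IsCubicCharacter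

open Finset

variable {F : Type*} [Field F] [Fintype F] {s : ℕ} {χ : MulChar F ℂ} {g : F}

theorem pos (h : IsCubicCharacter s χ g) : 0 < s := by
  have := h.card
  have h2 : 1 < Fintype.card F := Fintype.one_lt_card
  omega

theorem ne_zero (h : IsCubicCharacter s χ g) : g ≠ 0 :=
  h.isPrimitiveRoot.ne_zero (by have := h.pos; omega)

theorem apply_pow_three (h : IsCubicCharacter s χ g) {x : F} (hx : x ≠ 0) : χ x ^ 3 = 1 := by
  have := MulChar.pow_apply_coe χ 3 (Units.mk0 x hx)
  rw [h.pow_three, MulChar.one_apply_coe] at this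
  exact this.symm

theorem apply_ne_zero {F : Type*} [Field F] {χ : MulChar F ℂ} {x : F} : χ x ≠ 0 ↔ x ≠ 0 := by
  rw [MulChar.apply_ne_zero_iff, isUnit_iff_ne_zero]

theorem inv_apply (h : IsCubicCharacter s χ g) (x : F) : χ⁻¹ x = χ x ^ 2 := by
  rw [← MulChar.pow_apply' χ two_ne_zero]
  congr 1
  rw [inv_eq_iff_mul_eq_one, ← pow_succ', h.pow_three]

theorem ne_one (h : IsCubicCharacter s χ g) : χ ≠ 1 := by
  rintro rfl
  refine h.isPrimitiveRoot_apply.ne_one (by norm_num) ?_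
  exact MulChar.one_apply (isUnit_iff_ne_zero.2 h.ne_zero)

theorem apply_neg_one (h : IsCubicCharacter s χ g) : χ (-1) = 1 :=
  MulChar.val_neg_one_eq_one_of_odd_order (n := 3) (by decide) h.pow_three

theorem apply_neg (h : IsCubicCharacter s χ g) (x : F) : χ (-x) = χ x := by
  rw [neg_eq_neg_one_mul, map_mul, h.apply_neg_one, one_mul]

theorem pow_eq_one_iff (h : IsCubicCharacter s χ g) {x : F} (hx : x ≠ 0) :
    x ^ s = 1 ↔ χ x = 1 := by
  obtain ⟨m, rfl⟩ := h.exists_pow x hx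
  rw [map_pow, h.isPrimitiveRoot_apply.pow_eq_one_iff_dvd, ← pow_mul,
    h.isPrimitiveRoot.pow_eq_one_iff_dvd]
  exact Nat.mul_dvd_mul_iff_right h.pos

theorem exists_eq_pow_three (h : IsCubicCharacter s χ g) {x : F} (hx : x ≠ 0) (h1 : χ x = 1) :
    ∃ v : F, v ≠ 0 ∧ x = v ^ 3 := by
  obtain ⟨m, rfl⟩ := h.exists_pow x hx
  rw [map_pow, h.isPrimitiveRoot_apply.pow_eq_one_iff_dvd] at h1
  obtain ⟨l, rfl⟩ := h1
  exact ⟨g ^ l, pow_ne_zero _ h.ne_zero, by rw [← pow_mul, mul_comm]⟩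

theorem pow_isPrimitiveRoot (h : IsCubicCharacter s χ g) : IsPrimitiveRoot (g ^ s) 3 :=
  h.isPrimitiveRoot.pow (by have := h.pos; omega) (mul_comm _ _)

theorem apply_eq_pow (h : IsCubicCharacter s χ g) {x : F} (hx : x ≠ 0) :
    ∃ i < 3, χ x = χ g ^ i ∧ x ^ s = (g ^ s) ^ i := by
  obtain ⟨m, rfl⟩ := h.exists_pow x hx
  refine ⟨m % 3, Nat.mod_lt _ (by norm_num), ?_, ?_⟩
  · rw [map_pow]
    exact pow_eq_pow_mod _ h.isPrimitiveRoot_apply.pow_eq_one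
  · rw [← pow_mul, mul_comm, pow_mul]
    exact pow_eq_pow_mod _ h.pow_isPrimitiveRoot.pow_eq_one

theorem one_add_add_sq {K : Type*} [Field K] {z : K} (hz : IsPrimitiveRoot z 3) :
    1 + z + z ^ 2 = 0 := by
  have := hz.geom_sum_eq_zero (by norm_num)
  simpa [Finset.sum_range_succ] using this

theorem sum_apply (h : IsCubicCharacter s χ g) : ∑ x, χ x = 0 :=
  MulChar.sum_eq_zero_of_ne_one h.ne_one

/-- The sum of `1 + χ u + χ u ^ 2` counts the cube roots of `u`. -/
theorem card_cube_roots (h : IsCubicCharacter s χ g) [DecidableEq F] (u : F) :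
    ((#{x : F | x ^ 3 = u} : ℕ) : ℂ) = 1 + χ u + χ u ^ 2 := by
  by_cases hu : u = 0
  · subst hu
    have : ({x : F | x ^ 3 = 0} : Finset F) = {0} := by ext x; simp
    rw [this, MulChar.map_zero]
    simp
  by_cases h1 : χ u = 1
  · obtain ⟨v, hv, rfl⟩ := h.exists_eq_pow_three hu h1
    have hz := h.pow_isPrimitiveRoot
    set z := g ^ s
    have hz0 := one_add_add_sq hz
    have hz1 : z ≠ 1 := hz.ne_one (by norm_num)
    have hzz : z ≠ 0 := hz.ne_zero (by norm_num)
    have : ({x : F | x ^ 3 = v ^ 3} : Finset F) = {v, v * z, v * z ^ 2} := by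
      ext x
      simp only [mem_filter, mem_univ, true_and, mem_insert, mem_singleton]
      rw [← sub_eq_zero]
      have e : x ^ 3 - v ^ 3 = (x - v) * ((x - v * z) * (x - v * z ^ 2)) := by
        linear_combination (x ^ 2 * v - x * v ^ 2 * z + v ^ 3 * (z - 1)) * hz0
      rw [e, mul_eq_zero, mul_eq_zero, sub_eq_zero, sub_eq_zero, sub_eq_zero]
    rw [this, card_insert_of_notMem, card_pair, h1]
    · norm_num
    · intro e
      have := mul_left_cancel₀ hv e
      apply hz1
      have e2 : z * (z - 1) = 0 := by linear_combination -this
      rcases mul_eq_zero.1 e2 with h0 | h0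
      · exact absurd h0 hzz
      · exact sub_eq_zero.1 h0
    · simp only [mem_insert, mem_singleton, not_or]
      constructor
      · intro e
        exact hz1 (mul_left_cancel₀ hv (by rw [← e, mul_one]))
      · intro e
        have h2 : z ^ 2 = 1 := mul_left_cancel₀ hv (by rw [← e, mul_one])
        have := (hz.pow_eq_one_iff_dvd 2).1 h2
        omega
  · have : ({x : F | x ^ 3 = u} : Finset F) = ∅ := by
      ext x
      simp only [mem_filter, mem_univ, true_and, notMem_empty, iff_false]
      rintro rfl
      have hx : x ≠ 0 := by rintro rfl; simp at hu
      exact h1 (by rw [map_pow, h.apply_pow_three hx])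
    rw [this]
    have h3 := h.apply_pow_three hu
    have : (χ u - 1) * (1 + χ u + χ u ^ 2) = 0 := by linear_combination h3
    rcases mul_eq_zero.1 this with h0 | h0
    · exact absurd (sub_eq_zero.1 h0) h1
    · rw [h0]; simp

theorem sum_comp_pow_three (h : IsCubicCharacter s χ g) (f : F → ℂ) :
    ∑ a, f (a ^ 3) = ∑ u, (1 + χ u + χ u ^ 2) * f u := by
  classical
  rw [← Finset.sum_fiberwise univ (fun a : F => a ^ 3)]
  refine Finset.sum_congr rfl fun u _ => ?_
  rw [← h.card_cube_roots u, ← nsmul_eq_mul, ← Finset.sum_const]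
  refine Finset.sum_congr rfl fun a ha => ?_
  rw [(mem_filter.1 ha).2]

theorem sum_apply_mul_apply_add_one (h : IsCubicCharacter s χ g) :
    ∑ u, χ u * χ (u + 1) = jacobiSum χ χ := by
  rw [jacobiSum, ← Equiv.sum_comp (Equiv.neg F)]
  refine Finset.sum_congr rfl fun u _ => ?_
  rw [Equiv.neg_apply, h.apply_neg, neg_add_eq_sub]

/-- An affine substitution carrying -c and -e to 0 and 1 turns the sum into J(χ, χ⁻¹) = -χ(-1) = -1;
the scaling factor χ(c - e)³ is 1. -/
theorem sum_apply_mul_apply_sq (h : IsCubicCharacter s χ g) {c e : F} (hce : c ≠ e) :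
    ∑ a, χ (a + c) * χ (a + e) ^ 2 = -1 := by
  have hd : c - e ≠ 0 := sub_ne_zero.2 hce
  have key := jacobiSum_nontrivial_inv (R := ℂ) h.ne_one
  rw [h.apply_neg_one, jacobiSum] at key
  rw [← key, ← Equiv.sum_comp ((Equiv.mulLeft₀ (c - e) hd).trans (Equiv.subRight c))]
  refine Finset.sum_congr rfl fun x _ => ?_
  have e1 : ((Equiv.mulLeft₀ (c - e) hd).trans (Equiv.subRight c)) x + c = (c - e) * x := by
    simp
  have e2 : ((Equiv.mulLeft₀ (c - e) hd).trans (Equiv.subRight c)) x + e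
      = -((c - e) * (1 - x)) := by
    simp; ring
  rw [e1, e2, h.apply_neg, map_mul, map_mul, h.inv_apply]
  linear_combination (χ x * χ (1 - x) ^ 2) * h.apply_pow_three hd

theorem sum_apply_add_one (h : IsCubicCharacter s χ g) : ∑ u, χ (u + 1) = 0 := by
  rw [← h.sum_apply]
  exact Equiv.sum_comp (Equiv.addRight (1 : F)) (fun x => χ x)

theorem sum_apply_pow_three_add_one (h : IsCubicCharacter s χ g) :
    ∑ a, χ (a ^ 3 + 1) = jacobiSum χ χ - 1 := by
  rw [h.sum_comp_pow_three (fun u => χ (u + 1))]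
  have e := h.sum_apply_mul_apply_sq (c := 1) (e := 0) one_ne_zero
  simp only [add_zero] at e
  calc ∑ u, (1 + χ u + χ u ^ 2) * χ (u + 1)
      = ∑ u, χ (u + 1) + ∑ u, χ u * χ (u + 1) + ∑ u, χ (u + 1) * χ u ^ 2 := by
        rw [← Finset.sum_add_distrib, ← Finset.sum_add_distrib]
        exact Finset.sum_congr rfl fun u _ => by ring
    _ = jacobiSum χ χ - 1 := by
        rw [h.sum_apply_add_one, h.sum_apply_mul_apply_add_one, e]
        ring

theorem inv (h : IsCubicCharacter s χ g) : IsCubicCharacter s χ⁻¹ g where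
  card := h.card
  isPrimitiveRoot_apply := by
    rw [h.inv_apply]
    exact h.isPrimitiveRoot_apply.pow_of_coprime 2 (by norm_num)
  pow_three := by rw [inv_pow, h.pow_three, inv_one]
  isPrimitiveRoot := h.isPrimitiveRoot
  exists_pow := h.exists_pow

end IsCubicCharacter

/-! ### Cubic Jacobi sums as Eisenstein integers. -/

theorem exists_int_of_mem_adjoin {μ z : ℂ} (hμ : IsPrimitiveRoot μ 3)
    (hz : z ∈ Algebra.adjoin ℤ {μ}) : ∃ c d : ℤ, z = c + d * μ := by
  have h0 := IsCubicCharacter.one_add_add_sq hμ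
  induction hz using Algebra.adjoin_induction with
  | mem x hx => exact ⟨0, 1, by simpa using hx⟩
  | algebraMap r => exact ⟨r, 0, by simp⟩
  | add x y _ _ hx hy =>
    obtain ⟨c, d, rfl⟩ := hx
    obtain ⟨c', d', rfl⟩ := hy
    exact ⟨c + c', d + d', by push_cast; ring⟩
  | mul x y _ _ hx hy =>
    obtain ⟨c, d, rfl⟩ := hx
    obtain ⟨c', d', rfl⟩ := hy
    refine ⟨c * c' - d * d', c * d' + d * c' - d * d', ?_⟩
    push_cast
    linear_combination (d * d' : ℂ) * h0

theorem star_jacobiSum {F : Type*} [Field F] [Fintype F] (χ ψ : MulChar F ℂ) :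
    star (jacobiSum χ ψ) = jacobiSum χ⁻¹ ψ⁻¹ := by
  simp only [jacobiSum, star_sum, star_mul', MulChar.star_apply']

theorem star_eq_sq_of_isPrimitiveRoot {μ : ℂ} (hμ : IsPrimitiveRoot μ 3) : star μ = μ ^ 2 := by
  have h1 : ‖μ‖ = 1 := hμ.norm'_eq_one (by norm_num)
  have h2 : star μ * μ = 1 := by
    rw [mul_comm, Complex.star_def, Complex.mul_conj, Complex.normSq_eq_norm_sq, h1]
    norm_num
  have h3 := hμ.pow_eq_one
  have h4 : μ ≠ 0 := hμ.ne_zero (by norm_num)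
  apply mul_right_cancel₀ h4
  rw [h2, ← h3]
  ring

namespace IsCubicCharacter

open Finset

section

variable {F : Type*} [Field F] [Fintype F] {s : ℕ} {χ : MulChar F ℂ} {g : F}

theorem jacobiSum_mul_star (h : IsCubicCharacter s χ g) :
    jacobiSum χ χ * jacobiSum χ⁻¹ χ⁻¹ = (Fintype.card F : ℂ) := by
  refine jacobiSum_mul_jacobiSum_inv ?_ h.ne_one h.ne_one ?_
  · rw [ringChar.eq_zero]
    exact (CharP.ringChar_ne_zero_of_finite F).symm
  · have : χ * χ = χ⁻¹ := by
      rw [eq_inv_iff_mul_eq_one, ← h.pow_three, pow_three']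
    rw [this, Ne, inv_eq_one]
    exact h.ne_one

/-- The Jacobi sum of a cubic character, in coordinates: the norm equation and the trace. -/
theorem exists_trace (h : IsCubicCharacter s χ g) :
    ∃ d e : ℤ, (Fintype.card F : ℤ) = (3 * d - 1) ^ 2 - (3 * d - 1) * (3 * e) + (3 * e) ^ 2 ∧
      jacobiSum χ χ + jacobiSum χ⁻¹ χ⁻¹ = ((2 * (3 * d - 1) - 3 * e : ℤ) : ℂ) := by
  have hμ := h.isPrimitiveRoot_apply
  set μ := χ g
  have h0 := one_add_add_sq hμ
  -- Here J = -1 + z(μ - 1)² and (μ - 1)² = -3μ. With z = c + dμ this gives J = (3d - 1) + 3(d -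
  -- c)μ, the source of the congruences mod 3.
  obtain ⟨z, hz, hJ⟩ := exists_jacobiSum_eq_neg_one_add (n := 3) (by norm_num) h.pow_three
    h.pow_three (by rw [h.card]; simp) hμ
  obtain ⟨c, d, rfl⟩ := exists_int_of_mem_adjoin hμ hz
  have hJ1 : jacobiSum χ χ = ((3 * d - 1 : ℤ) : ℂ) + ((3 * (d - c) : ℤ) : ℂ) * μ := by
    rw [hJ]
    push_cast
    linear_combination ((c : ℂ) + d * μ - 3 * d) * h0
  have hJ2 : jacobiSum χ⁻¹ χ⁻¹ = ((3 * d - 1 : ℤ) : ℂ) + ((3 * (d - c) : ℤ) : ℂ) * μ ^ 2 := by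
    rw [← star_jacobiSum, hJ1, ← star_eq_sq_of_isPrimitiveRoot hμ]
    simp
  refine ⟨d, d - c, ?_, ?_⟩
  · have := h.jacobiSum_mul_star
    rw [hJ1, hJ2] at this
    have e : ((Fintype.card F : ℤ) : ℂ) = (((3 * d - 1) ^ 2 - (3 * d - 1) * (3 * (d - c))
        + (3 * (d - c)) ^ 2 : ℤ) : ℂ) := by
      rw [Int.cast_natCast, ← this]
      push_cast
      linear_combination (3 * ((d : ℂ) - c) * (3 * d - 1) + 9 * ((d : ℂ) - c) ^ 2 * (μ - 1)) * h0
    exact_mod_cast e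
  · rw [hJ1, hJ2]
    push_cast
    linear_combination (3 * ((d : ℂ) - c)) * h0

end

/-! ### The permutation criterion and a polynomial detecting it. -/

section

variable {F : Type*} [Field F] [Fintype F] {s : ℕ} {χ : MulChar F ℂ} {g : F}

/-- The value of `χ` at `x ^ n * (x ^ s + a)` for any `x` with `χ x = χ g ^ i`. -/
noncomputable def classValue (s : ℕ) (χ : MulChar F ℂ) (g : F) (n : ℕ) (a : F) (i : ℕ) : ℂ :=
  (χ g ^ n) ^ i * χ ((g ^ s) ^ i + a)

/-- The three values of `χ` on the cosets are nonzero and distinct. -/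
def Separated (u : ℕ → ℂ) : Prop :=
  u 0 ≠ 0 ∧ u 1 ≠ 0 ∧ u 2 ≠ 0 ∧ u 0 ≠ u 1 ∧ u 0 ≠ u 2 ∧ u 1 ≠ u 2

theorem eval_cubicBinomial (h : IsCubicCharacter s χ g) (n : ℕ) (a x : F) :
    (cubicBinomial F n a).eval x = x ^ n * (x ^ s + a) := by
  simp [cubicBinomial, h.card]

theorem apply_eval {F : Type*} [Field F] {s : ℕ} {χ : MulChar F ℂ} {g : F} (n : ℕ) (a : F) {x : F} {i : ℕ} (h1 : χ x = χ g ^ i)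
    (h2 : x ^ s = (g ^ s) ^ i) : χ (x ^ n * (x ^ s + a)) = classValue s χ g n a i := by
  rw [map_mul, map_pow, h1, h2, classValue, ← pow_mul, mul_comm i n, pow_mul]

/-- Zero is the only preimage of 0, so no class value vanishes; by surjectivity the three class
values exhaust the three cube roots of unity, hence are distinct. -/
theorem separated_of_bijective (h : IsCubicCharacter s χ g) {n : ℕ} (hn : 0 < n) {a : F}
    (hb : Function.Bijective fun x : F => x ^ n * (x ^ s + a)) :
    Separated (classValue s χ g n a) := by
  classical
  set u := classValue s χ g n a with hu
  have hne : ∀ i, u i ≠ 0 := by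
    intro i
    rw [hu, ← apply_eval (x := g ^ i) n a (map_pow χ g i) (by rw [← pow_mul, ← pow_mul, mul_comm]),
      apply_ne_zero]
    intro h0
    have : g ^ i = 0 := hb.1 (by simp only; rw [h0, zero_pow hn.ne', zero_mul])
    exact pow_ne_zero i h.ne_zero this
  have hsurj : ∀ i, χ g ^ i = u 0 ∨ χ g ^ i = u 1 ∨ χ g ^ i = u 2 := by
    intro i
    obtain ⟨x, hx⟩ := hb.2 (g ^ i)
    simp only at hx
    have hx0 : x ≠ 0 := by
      rintro rfl
      rw [zero_pow hn.ne', zero_mul] at hx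
      exact pow_ne_zero i h.ne_zero hx.symm
    obtain ⟨j, hj, h1, h2⟩ := h.apply_eq_pow hx0
    have e := apply_eval n a h1 h2
    rw [hx, map_pow] at e
    rw [e]
    interval_cases j <;> simp [hu]
  have hz := h.isPrimitiveRoot_apply
  have h10 : χ g ≠ 1 := hz.ne_one (by norm_num)
  have h20 : χ g ^ 2 ≠ 1 := fun e => by have := (hz.pow_eq_one_iff_dvd 2).1 e; omega
  have h21 : χ g ^ 2 ≠ χ g := fun e => h10 (by
    have := hz.ne_zero (by norm_num)
    field_simp at e
    exact e)
  have s0 := hsurj 0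
  have s1 := hsurj 1
  have s2 := hsurj 2
  simp only [pow_zero, pow_one] at s0 s1 s2
  refine ⟨hne 0, hne 1, hne 2, ?_, ?_, ?_⟩ <;> intro e <;> grind

/-- Equal nonzero values come from the same coset, so x^s = y^s and, after cancelling, x^n = y^n.
The order of x / y then divides gcd(n, s) = 1. -/
theorem bijective_of_separated (h : IsCubicCharacter s χ g) {n : ℕ} (hn : 0 < n)
    (hns : Nat.gcd n s = 1) {a : F} (hu : Separated (classValue s χ g n a)) :
    Function.Bijective fun x : F => x ^ n * (x ^ s + a) := by
  rw [← Finite.injective_iff_bijective]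
  obtain ⟨h0, h1, h2, h01, h02, h12⟩ := hu
  have key : ∀ x : F, x ≠ 0 → x ^ n * (x ^ s + a) ≠ 0 := by
    intro x hx
    obtain ⟨i, hi, e1, e2⟩ := h.apply_eq_pow hx
    rw [← apply_ne_zero (χ := χ), apply_eval n a e1 e2]
    interval_cases i <;> assumption
  intro x y hxy
  simp only at hxy
  by_cases hx : x = 0
  · by_contra hne
    subst hx
    rw [zero_pow hn.ne', zero_mul] at hxy
    exact key y (Ne.symm hne) hxy.symm
  by_cases hy : y = 0
  · subst hy
    rw [zero_pow hn.ne', zero_mul] at hxy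
    exact absurd hxy (key x hx)
  obtain ⟨i, hi, e1, e2⟩ := h.apply_eq_pow hx
  obtain ⟨j, hj, e3, e4⟩ := h.apply_eq_pow hy
  have e := apply_eval n a e1 e2
  rw [hxy, apply_eval n a e3 e4] at e
  have hij : i = j := by
    interval_cases i <;> interval_cases j <;> first | rfl | (exfalso; grind)
  subst hij
  have hs : x ^ s = y ^ s := e2.trans e4.symm
  have hne := right_ne_zero_of_mul (key x hx)
  rw [hs] at hxy hne
  have hn' := mul_right_cancel₀ hne hxy
  have o1 : (x / y) ^ n = 1 := by rw [div_pow, hn', div_self (pow_ne_zero _ hy)]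
  have o2 : (x / y) ^ s = 1 := by rw [div_pow, hs, div_self (pow_ne_zero _ hy)]
  have := Nat.dvd_gcd (orderOf_dvd_of_pow_eq_one o1) (orderOf_dvd_of_pow_eq_one o2)
  rw [hns, Nat.dvd_one, orderOf_eq_one_iff, div_eq_one_iff_eq hy] at this
  exact this

/-- An element of order gcd(n, s) has the same image 1 + a as the element 1. -/
theorem gcd_eq_one_of_injective (h : IsCubicCharacter s χ g) {n : ℕ} {a : F}
    (hb : Function.Injective fun x : F => x ^ n * (x ^ s + a)) : Nat.gcd n s = 1 := by
  set d := Nat.gcd n s with hd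
  have hs := h.pos
  have hds : d ∣ s := Nat.gcd_dvd_right n s
  have hdn : d ∣ n := Nat.gcd_dvd_left n s
  obtain ⟨m, hm⟩ : d ∣ 3 * s := hds.mul_left 3
  have hr : IsPrimitiveRoot (g ^ m) d := h.isPrimitiveRoot.pow (by omega) (by rw [hm, mul_comm])
  have h1 : g ^ m = 1 := by
    apply hb
    simp only
    rw [(hr.pow_eq_one_iff_dvd n).2 hdn, (hr.pow_eq_one_iff_dvd s).2 hds]
    simp
  rw [h1] at hr
  exact hr.unique IsPrimitiveRoot.one

/-- A polynomial in the values of `χ` that is `9` if they are separated, and `0` if they are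
nonzero and not separated. -/
def separation (u : ℕ → ℂ) : ℂ :=
  2 * (1 + u 0 * u 1 * u 2 + (u 0 * u 1 * u 2) ^ 2) -
    (u 0 * u 1 ^ 2 + u 1 * u 0 ^ 2 + (u 0 * u 2 ^ 2 + u 2 * u 0 ^ 2) +
      (u 1 * u 2 ^ 2 + u 2 * u 1 ^ 2))

/-- With P the product of the values, 1 + P + P² is 3 if P = 1 and 0 otherwise, while x y² + y x² =
x/y + y/x is 2 if x = y and -1 otherwise. Three distinct values give 6 + 3, three equal ones 6 - 6,
and exactly two equal ones 0 - (2 - 1 - 1). -/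
theorem separation_eq {u : ℕ → ℂ} (h : ∀ i < 3, u i ^ 3 = 1) [Decidable (Separated u)] :
    separation u = if Separated u then 9 else 0 := by
  have h0 := h 0 (by norm_num)
  have h1 := h 1 (by norm_num)
  have h2 := h 2 (by norm_num)
  have n0 : u 0 ≠ 0 := by intro e; simp [e] at h0
  have n1 : u 1 ≠ 0 := by intro e; simp [e] at h1
  have n2 : u 2 ≠ 0 := by intro e; simp [e] at h2
  have q : ∀ x y : ℂ, x ^ 3 = 1 → y ^ 3 = 1 → x ≠ y → x ^ 2 + x * y + y ^ 2 = 0 := by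
    intro x y hx hy hxy
    have : (x - y) * (x ^ 2 + x * y + y ^ 2) = 0 := by linear_combination hx - hy
    exact (mul_eq_zero.1 this).resolve_left (sub_ne_zero.2 hxy)
  have aux : ∀ x y : ℂ, x ^ 3 = 1 → y ^ 3 = 1 →
      2 * (1 + x * x * y + (x * x * y) ^ 2) -
        (x * x ^ 2 + x * x ^ 2 + (x * y ^ 2 + y * x ^ 2) + (x * y ^ 2 + y * x ^ 2)) = 0 := by
    intro x y hx hy
    linear_combination (2 * x * y ^ 2 - 2) * hx
  rw [separation]
  by_cases h01 : u 0 = u 1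
  · rw [if_neg (fun e => e.2.2.2.1 h01), ← h01]
    exact aux _ _ h0 h2
  by_cases h02 : u 0 = u 2
  · rw [if_neg (fun e => e.2.2.2.2.1 h02), ← h02]
    linear_combination aux _ _ h0 h1
  by_cases h12 : u 1 = u 2
  · rw [if_neg (fun e => e.2.2.2.2.2 h12), ← h12]
    linear_combination aux _ _ h1 h0
  rw [if_pos ⟨n0, n1, n2, h01, h02, h12⟩]
  have q01 := q _ _ h0 h1 h01
  have q02 := q _ _ h0 h2 h02
  have q12 := q _ _ h1 h2 h12
  have hsum : u 0 + u 1 + u 2 = 0 := by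
    have : (u 1 - u 2) * (u 0 + u 1 + u 2) = 0 := by linear_combination q01 - q02
    exact (mul_eq_zero.1 this).resolve_left (sub_ne_zero.2 h12)
  have e2 : u 2 = -u 0 - u 1 := by linear_combination hsum
  have hP : u 0 * u 1 * u 2 = 1 := by
    rw [e2]
    linear_combination h0 - u 0 * q01
  rw [hP]
  have : u 0 * u 1 ^ 2 + u 1 * u 0 ^ 2 + (u 0 * u 2 ^ 2 + u 2 * u 0 ^ 2) +
      (u 1 * u 2 ^ 2 + u 2 * u 1 ^ 2) = -3 := by
    linear_combination (u 0 * u 1 + u 0 * u 2 + u 1 * u 2) * hsum - 3 * hP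
  rw [this]
  norm_num

end

end IsCubicCharacter

/-! ### Summing over a: the exact count in terms of the trace. -/

namespace IsCubicCharacter

open Finset

variable {F : Type*} [Field F] [Fintype F] {s : ℕ} {χ : MulChar F ℂ} {g : F}

theorem apply_pow_pow_three (h : IsCubicCharacter s χ g) (n : ℕ) : (χ g ^ n) ^ 3 = 1 := by
  rw [← pow_mul, mul_comm, pow_mul, h.isPrimitiveRoot_apply.pow_eq_one, one_pow]

theorem sum_mul_sq (h : IsCubicCharacter s χ g) {c e : F} (hce : c ≠ e) :
    ∑ a, χ (c + a) * χ (e + a) ^ 2 = -1 := by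
  simp_rw [add_comm c, add_comm e]
  exact h.sum_apply_mul_apply_sq hce

/-- Since (1 + a)(z + a)(z² + a) = a³ + 1 and θ³ = 1, the product terms become sums of χ(a³ + 1) and
its conjugate. Each of the six cross terms is -1 times θ or θ², three of each kind. -/
theorem sum_separation (h : IsCubicCharacter s χ g) (n : ℕ) :
    ∑ a, separation (classValue s χ g n a) =
      2 * (Fintype.card F + (jacobiSum χ χ - 1) + (jacobiSum χ⁻¹ χ⁻¹ - 1)) +
        3 * (χ g ^ n + (χ g ^ n) ^ 2) := by
  have hθ := h.apply_pow_pow_three n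
  set θ := χ g ^ n with hθd
  have hz := h.pow_isPrimitiveRoot
  set z := g ^ s with hzd
  have hz0 := one_add_add_sq hz
  have h01 : (1 : F) ≠ z := (hz.ne_one (by norm_num)).symm
  have h02 : (1 : F) ≠ z ^ 2 := fun e => by
    have := (hz.pow_eq_one_iff_dvd 2).1 e.symm; omega
  have h12 : z ≠ z ^ 2 := fun e => h01 (by
    have := hz.ne_zero (by norm_num)
    rw [sq] at e
    exact mul_left_cancel₀ this (by rw [mul_one]; exact e))
  have hP : ∀ a : F, χ (1 + a) * χ (z + a) * χ (z ^ 2 + a) = χ (a ^ 3 + 1) := by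
    intro a
    rw [← map_mul, ← map_mul]
    congr 1
    linear_combination (a ^ 2 + a * z + z - 1) * hz0
  have e : ∀ a : F, separation (classValue s χ g n a) =
      2 * (1 + χ (a ^ 3 + 1) + χ⁻¹ (a ^ 3 + 1)) -
      (θ ^ 2 * (χ (1 + a) * χ (z + a) ^ 2) + θ * (χ (z + a) * χ (1 + a) ^ 2) +
       (θ * (χ (1 + a) * χ (z ^ 2 + a) ^ 2) + θ ^ 2 * (χ (z ^ 2 + a) * χ (1 + a) ^ 2)) +
       (θ ^ 2 * (χ (z + a) * χ (z ^ 2 + a) ^ 2) + θ * (χ (z ^ 2 + a) * χ (z + a) ^ 2))) := by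
    intro a
    rw [h.inv_apply, ← hP]
    simp only [separation, classValue, ← hθd, ← hzd, pow_zero, pow_one, one_mul]
    generalize χ (1 + a) = x
    generalize χ (z + a) = y
    generalize χ (z ^ 2 + a) = w
    linear_combination (2 * x * y * w + 2 * (x * y * w) ^ 2 * (1 + θ ^ 3)
      - θ * x * w ^ 2 - θ ^ 2 * (y * w ^ 2) - θ * (w * y ^ 2)) * hθ
  simp_rw [e]
  rw [sum_sub_distrib]
  simp only [← mul_sum, sum_add_distrib]
  rw [h.sum_mul_sq h01, h.sum_mul_sq h01.symm, h.sum_mul_sq h02, h.sum_mul_sq h02.symm,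
    h.sum_mul_sq h12, h.sum_mul_sq h12.symm, h.sum_apply_pow_three_add_one,
    h.inv.sum_apply_pow_three_add_one]
  simp only [sum_const, card_univ, nsmul_eq_mul, mul_one]
  ring

/-- At the three points a = -z^l one class value vanishes and `separation_eq` is not available. The
remaining two involve differences of cube roots of unity, whose characters agree with χ(z - 1) up to
powers of χ(z), so the correction is the same for all l. -/
theorem separation_neg (h : IsCubicCharacter s χ g) (n : ℕ) {l : ℕ} (hl : l < 3) :
    separation (classValue s χ g n (-(g ^ s) ^ l)) =
      2 - (χ g ^ n) ^ 2 * χ g ^ s - χ g ^ n * (χ g ^ s) ^ 2 := by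
  have hθ := h.apply_pow_pow_three n
  have hη := h.apply_pow_pow_three s
  have hχz : χ (g ^ s) = χ g ^ s := map_pow χ g s
  set θ := χ g ^ n with hθd
  set η := χ g ^ s with hηd
  have hz := h.pow_isPrimitiveRoot
  set z := g ^ s with hzd
  have hz0 := one_add_add_sq hz
  have hz1 : z - 1 ≠ 0 := sub_ne_zero.2 (hz.ne_one (by norm_num))
  have hx := h.apply_pow_three hz1
  have e0 : χ (1 + -1) = 0 := by rw [add_neg_cancel, MulChar.map_zero]
  have e1 : χ (z + -1) = χ (z - 1) := by rw [sub_eq_add_neg]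
  have e2 : χ (z ^ 2 + -1) = η ^ 2 * χ (z - 1) := by
    have : z ^ 2 + -1 = -(z ^ 2 * (z - 1)) := by linear_combination (z - 1) * hz0
    rw [this, h.apply_neg, map_mul, map_pow, hχz]
  have f0 : χ (1 + -z) = χ (z - 1) := by rw [← h.apply_neg]; congr 1; ring
  have f1 : χ (z + -z) = 0 := by rw [add_neg_cancel, MulChar.map_zero]
  have f2 : χ (z ^ 2 + -z) = η * χ (z - 1) := by
    rw [← hχz, ← map_mul]; congr 1; ring
  have g0 : χ (1 + -z ^ 2) = η ^ 2 * χ (z - 1) := by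
    rw [← e2, ← h.apply_neg]; congr 1; ring
  have g1 : χ (z + -z ^ 2) = η * χ (z - 1) := by
    rw [← f2, ← h.apply_neg]; congr 1; ring
  have g2 : χ (z ^ 2 + -z ^ 2) = 0 := by rw [add_neg_cancel, MulChar.map_zero]
  interval_cases l
  · simp only [separation, classValue, ← hθd, ← hzd, pow_zero, pow_one, one_mul, e0, e1, e2]
    generalize χ (z - 1) = x at *
    linear_combination (-θ ^ 5 * η ^ 4 - θ ^ 4 * η ^ 2) * hx + (-θ ^ 2 * η - θ * η ^ 2) * hθ * 1
      - (θ ^ 5 * η) * hη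
  · simp only [separation, classValue, ← hθd, ← hzd, pow_zero, pow_one, one_mul, f0, f1, f2]
    generalize χ (z - 1) = x at *
    linear_combination (-θ ^ 4 * η ^ 2 - θ ^ 2 * η) * hx - θ * η ^ 2 * hθ
  · simp only [separation, classValue, ← hθd, ← hzd, pow_zero, pow_one, one_mul, g0, g1, g2]
    generalize χ (z - 1) = x at *
    linear_combination (-θ ^ 2 * η ^ 4 - θ * η ^ 5) * hx - (θ ^ 2 * η + θ * η ^ 2) * hη

theorem separation_add (h : IsCubicCharacter s χ g) [DecidableEq F] (n : ℕ) (a : F)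
    [Decidable (Separated (classValue s χ g n a))] :
    separation (classValue s χ g n a) =
      (if Separated (classValue s χ g n a) then 9 else 0) +
      if a ∈ (range 3).image (fun l => -(g ^ s) ^ l) then
        2 - (χ g ^ n) ^ 2 * χ g ^ s - χ g ^ n * (χ g ^ s) ^ 2 else 0 := by
  by_cases ha : a ∈ (range 3).image (fun l => -(g ^ s) ^ l)
  · rw [if_pos ha]
    obtain ⟨l, hl, rfl⟩ := mem_image.1 ha
    rw [mem_range] at hl
    rw [h.separation_neg n hl, if_neg, zero_add]
    have : classValue s χ g n (-(g ^ s) ^ l) l = 0 := by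
      rw [classValue, add_neg_cancel, MulChar.map_zero, mul_zero]
    rintro ⟨h0, h1, h2, -⟩
    interval_cases l <;> contradiction
  · rw [if_neg ha, add_zero]
    apply separation_eq
    intro i hi
    rw [classValue, mul_pow, ← pow_mul, mul_comm i 3, pow_mul, h.apply_pow_pow_three n, one_pow,
      one_mul]
    apply h.apply_pow_three
    intro e
    exact ha (mem_image.2 ⟨i, mem_range.2 hi, by linear_combination -e⟩)

theorem nine_mul_ncard_separated (h : IsCubicCharacter s χ g) (n : ℕ) :
    9 * ((Set.ncard {a : F | Separated (classValue s χ g n a)} : ℕ) : ℂ) =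
      2 * Fintype.card F - 10 + 2 * (jacobiSum χ χ + jacobiSum χ⁻¹ χ⁻¹) +
        3 * (χ g ^ n + (χ g ^ n) ^ 2) +
        3 * ((χ g ^ n) ^ 2 * χ g ^ s + χ g ^ n * (χ g ^ s) ^ 2) := by
  classical
  have hc : #((range 3).image (fun l => -(g ^ s) ^ l)) = 3 := by
    rw [card_image_of_injOn, card_range]
    intro i hi j hj hij
    exact h.pow_isPrimitiveRoot.pow_inj (by simpa using hi) (by simpa using hj) (neg_injective hij)
  have e := h.sum_separation n
  simp_rw [h.separation_add n] at e
  rw [sum_add_distrib, sum_ite_mem, univ_inter, sum_const, hc, ← sum_filter, sum_const,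
    nsmul_eq_mul] at e
  have : Set.ncard {a : F | Separated (classValue s χ g n a)} =
      #{a : F | Separated (classValue s χ g n a)} := by
    rw [← Set.ncard_coe_finset]
    congr 1
    ext a
    simp
  rw [this]
  rw [nsmul_eq_mul] at e
  push_cast at e
  linear_combination e

theorem permBinomialCount_eq_ncard (h : IsCubicCharacter s χ g) {n : ℕ} (hn : 0 < n)
    (hns : Nat.gcd n s = 1) :
    permBinomialCount F n = Set.ncard {a : F | Separated (classValue s χ g n a)} := by
  rw [permBinomialCount]
  congr 1
  ext a
  simp only [Set.mem_ofPred_eq, IsPermutationPolynomial, h.eval_cubicBinomial]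
  exact ⟨h.separated_of_bijective hn, h.bijective_of_separated hn hns⟩

theorem permBinomialCount_eq_zero (h : IsCubicCharacter s χ g) {n : ℕ}
    (hns : Nat.gcd n s ≠ 1) : permBinomialCount F n = 0 := by
  rw [permBinomialCount, Set.ncard_eq_zero, Set.eq_empty_iff_forall_notMem]
  intro a ha
  simp only [Set.mem_ofPred_eq, IsPermutationPolynomial, h.eval_cubicBinomial] at ha
  exact hns (h.gcd_eq_one_of_injective ha.1)

/-- The number of permutation binomials in terms of the trace `t` of the Jacobi sums. -/
theorem nine_mul_permBinomialCount (h : IsCubicCharacter s χ g) {n : ℕ} (hn : 0 < n)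
    (hns : Nat.gcd n s = 1) {t : ℤ} (ht : jacobiSum χ χ + jacobiSum χ⁻¹ χ⁻¹ = t) :
    (9 * permBinomialCount F n : ℤ) = 2 * Fintype.card F + 2 * t - 7 ∨
      (9 * permBinomialCount F n : ℤ) = 2 * Fintype.card F + 2 * t - 16 := by
  have e := h.nine_mul_ncard_separated n
  rw [← h.permBinomialCount_eq_ncard hn hns, ht] at e
  have hθ := h.apply_pow_pow_three n
  have hη := h.apply_pow_pow_three s
  -- Coprimality of n and s prevents 3 from dividing both.
  have hne : χ g ^ n ≠ 1 ∨ χ g ^ s ≠ 1 := by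
    rw [Ne, Ne, h.isPrimitiveRoot_apply.pow_eq_one_iff_dvd,
      h.isPrimitiveRoot_apply.pow_eq_one_iff_dvd, ← not_and_or]
    rintro ⟨h1, h2⟩
    have := Nat.dvd_gcd h1 h2
    rw [hns] at this
    omega
  generalize χ g ^ n = θ at *
  generalize χ g ^ s = η at *
  have q : ∀ x : ℂ, x ^ 3 = 1 → x ≠ 1 → x + x ^ 2 = -1 := by
    intro x hx hx1
    have : (x - 1) * (x ^ 2 + x + 1) = 0 := by linear_combination hx
    have := (mul_eq_zero.1 this).resolve_left (sub_ne_zero.2 hx1)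
    linear_combination this
  -- The root-of-unity terms are 3(θ + θ²) + 3(y + y²) with y = θ²η. Each bracket is 2 or -1 and not
  -- both are 2. If y = 1 or θ = 1 the total is 3, turning -10 into -7; otherwise it is -6, giving
  -- -16.
  by_cases h1 : θ = 1
  · left
    subst h1
    have := q η hη (by simpa using hne)
    have : (9 * permBinomialCount F n : ℂ) = 2 * Fintype.card F + 2 * t - 7 := by
      linear_combination e + 3 * this
    exact_mod_cast this
  · have hθ2 := q θ hθ h1
    by_cases h2 : η = θ
    · left
      subst h2
      have : (9 * permBinomialCount F n : ℂ) = 2 * Fintype.card F + 2 * t - 7 := by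
        linear_combination e + 3 * hθ2 + 6 * hθ
      exact_mod_cast this
    · right
      have h3 := q (θ ^ 2 * η) (by linear_combination (θ ^ 3 * η ^ 3 + η ^ 3) * hθ + hη) (by
        intro h4
        exact h2 (by linear_combination θ * h4 - η * hθ))
      have : (9 * permBinomialCount F n : ℂ) = 2 * Fintype.card F + 2 * t - 16 := by
        linear_combination e + 3 * hθ2 + 3 * h3 - 3 * θ * η ^ 2 * hθ
      exact_mod_cast this

end IsCubicCharacter

/-! ### The trace modulo p. -/

/-- With p = 3c + 1, all k base-p digits of s equal c, and doubling produces no carry. Lucas'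
theorem reduces the binomial to powers of C(2c, c), which divides (2c)! with 2c < p. -/
theorem not_dvd_choose_two_mul {p : ℕ} (hp : p.Prime) (h1 : p % 3 = 1) (k s : ℕ)
    (hs : p ^ k = 3 * s + 1) : ¬ p ∣ Nat.choose (2 * s) s := by
  have := Fact.mk hp
  induction k generalizing s with
  | zero =>
    have : s = 0 := by simp at hs; omega
    subst this
    simpa using hp.one_lt.ne'
  | succ k ih =>
    obtain ⟨c, hc⟩ : ∃ c, p = 3 * c + 1 := ⟨p / 3, by omega⟩
    obtain ⟨s', hs'⟩ : ∃ s', p ^ k = 3 * s' + 1 := by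
      have : p ^ k % 3 = 1 := by rw [Nat.pow_mod, h1]; simp
      exact ⟨p ^ k / 3, by omega⟩
    have hss : s = c + p * s' := by
      rw [pow_succ, hs'] at hs
      nlinarith
    have h2 : 2 * s = 2 * c + p * (2 * s') := by rw [hss]; ring
    have hL := Choose.choose_modEq_choose_mod_mul_choose_div_nat (n := 2 * s) (k := s) (p := p)
    have hp0 := hp.pos
    rw [h2, Nat.add_mul_mod_self_left, Nat.add_mul_div_left _ _ hp0, hss,
      Nat.add_mul_mod_self_left, Nat.add_mul_div_left _ _ hp0,
      Nat.mod_eq_of_lt (by omega : 2 * c < p), Nat.mod_eq_of_lt (by omega : c < p),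
      Nat.div_eq_of_lt (by omega : 2 * c < p), Nat.div_eq_of_lt (by omega : c < p),
      zero_add, zero_add] at hL
    rw [h2, hss, hL.dvd_iff dvd_rfl, hp.dvd_mul, not_or]
    refine ⟨fun hd => ?_, ih s' hs'⟩
    have e := Nat.add_choose_mul_factorial_mul_factorial c c
    rw [← two_mul, mul_assoc] at e
    have := hp.dvd_factorial.1 (hd.trans (Dvd.intro _ e))
    omega

namespace IsCubicCharacter

open Finset

variable {F : Type*} [Field F] [Fintype F] {s : ℕ} {χ : MulChar F ℂ} {g : F}

/-- Characteristic p analogue of `card_cube_roots`, with u^s in the role of χ u. -/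
theorem card_cube_roots_cast (h : IsCubicCharacter s χ g) [DecidableEq F] (u : F) :
    ((#{x : F | x ^ 3 = u} : ℕ) : F) = 1 + u ^ s + u ^ (2 * s) := by
  have hc := h.card_cube_roots u
  have hs := h.pos
  by_cases hu : u = 0
  · subst hu
    rw [MulChar.map_zero] at hc
    have : (#{x : F | x ^ 3 = 0} : ℕ) = 1 := by
      refine Nat.cast_injective (R := ℂ) ?_
      rw [hc]
      norm_num
    rw [this, zero_pow hs.ne', zero_pow (by omega)]
    simp
  by_cases h1 : χ u = 1
  · rw [h1] at hc
    have : (#{x : F | x ^ 3 = u} : ℕ) = 3 := by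
      refine Nat.cast_injective (R := ℂ) ?_
      rw [hc]
      norm_num
    rw [this, mul_comm 2 s, pow_mul, (h.pow_eq_one_iff hu).2 h1]
    norm_num
  · have h3 := h.apply_pow_three hu
    have e : (χ u - 1) * (1 + χ u + χ u ^ 2) = 0 := by linear_combination h3
    rw [(mul_eq_zero.1 e).resolve_left (sub_ne_zero.2 h1)] at hc
    rw [Nat.cast_eq_zero.1 hc, mul_comm 2 s, pow_mul]
    have h4 : (u ^ s) ^ 3 = 1 := by
      obtain ⟨m, rfl⟩ := h.exists_pow u hu
      rw [← pow_mul, ← pow_mul, h.isPrimitiveRoot.pow_eq_one_iff_dvd]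
      exact ⟨m, by ring⟩
    have e2 : (u ^ s - 1) * (1 + u ^ s + (u ^ s) ^ 2) = 0 := by linear_combination h4
    rw [(mul_eq_zero.1 e2).resolve_left (sub_ne_zero.2 (fun e => h1 ((h.pow_eq_one_iff hu).1 e)))]
    simp

/-- Exponent 0 also gives 0, since 0^0 = 1 and q = 0 in F; the bound 6s = 2(q - 1) excludes the next
multiple of q - 1. -/
theorem sum_pow (h : IsCubicCharacter s χ g) {i : ℕ} (hi : i < 6 * s) :
    ∑ u : F, u ^ i = if i = 3 * s then -1 else 0 := by
  classical
  have hs := h.pos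
  have hq : Fintype.card F - 1 = 3 * s := by rw [h.card]; simp
  rcases lt_trichotomy i (3 * s) with hlt | rfl | hgt
  · rw [if_neg hlt.ne]
    exact FiniteField.sum_pow_lt_card_sub_one F i (by rw [hq]; exact hlt)
  · rw [if_pos rfl, ← add_sum_erase _ _ (mem_univ (0 : F)), zero_pow (by omega), zero_add,
      sum_congr rfl (g := fun _ => 1)]
    · rw [sum_const, card_erase_of_mem (mem_univ _), card_univ, hq, nsmul_eq_mul, mul_one]
      have : ((Fintype.card F : ℕ) : F) = 0 := FiniteField.cast_card_eq_zero F
      rw [h.card] at this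
      push_cast at this ⊢
      linear_combination this
    · intro x hx
      rw [← hq]
      exact FiniteField.pow_card_sub_one_eq_one x (ne_of_mem_erase hx)
  · rw [if_neg hgt.ne', ← FiniteField.sum_pow_lt_card_sub_one F (i - 3 * s) (by rw [hq]; omega)]
    refine sum_congr rfl fun x _ => ?_
    by_cases hx : x = 0
    · rw [hx, zero_pow (by omega), zero_pow (by omega)]
    · conv_lhs => rw [show i = (i - 3 * s) + 3 * s by omega, pow_add, ← hq,
        FiniteField.pow_card_sub_one_eq_one x hx, mul_one]
      rw [hq]

theorem sum_pow_mul_add_one_pow (h : IsCubicCharacter s χ g) {a b : ℕ} (ha : a ≤ 2) (hb : b ≤ 2) :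
    ∑ u : F, u ^ (a * s) * (u + 1) ^ (b * s) = -(Nat.choose (b * s) ((3 - a) * s) : F) := by
  have hs := h.pos
  have ha' : a * s ≤ 2 * s := Nat.mul_le_mul_right s ha
  have hb' : b * s ≤ 2 * s := Nat.mul_le_mul_right s hb
  have hd : (3 - a) * s + a * s = 3 * s := by rw [← add_mul]; congr 1; omega
  simp_rw [add_pow, mul_sum]
  rw [sum_comm]
  have e : ∀ j ∈ range (b * s + 1), ∑ u : F, u ^ (a * s) * (u ^ j * 1 ^ (b * s - j) *
      (Nat.choose (b * s) j : F)) =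
      if j = (3 - a) * s then -(Nat.choose (b * s) j : F) else 0 := by
    intro j hj
    rw [mem_range] at hj
    have := h.sum_pow (i := a * s + j) (by omega)
    simp_rw [one_pow, mul_one, ← mul_assoc, ← pow_add]
    rw [← sum_mul, this]
    by_cases hj2 : j = (3 - a) * s
    · rw [if_pos (by omega), if_pos hj2, neg_one_mul]
    · rw [if_neg (by omega), if_neg hj2, zero_mul]
  rw [sum_congr rfl e, sum_ite_eq']
  split_ifs with hm
  · rfl
  · rw [Nat.choose_eq_zero_of_lt (by simpa [Nat.lt_succ_iff] using hm)]
    simp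

/-- The trace of the Jacobi sums is minus a central binomial coefficient in `F`. -/
theorem trace_cast (h : IsCubicCharacter s χ g) {t : ℤ}
    (ht : jacobiSum χ χ + jacobiSum χ⁻¹ χ⁻¹ = t) : (t : F) = -(Nat.choose (2 * s) s : F) := by
  classical
  have hs := h.pos
  set r : F → ℕ := fun u => #{x : F | x ^ 3 = u} with hr
  -- This sum counts the affine points of y³ = x³ + 1. It is evaluated through χ in ℂ, then through
  -- power sums in F, and the two results are compared.
  have hC : ((∑ u, r u * r (u + 1) : ℕ) : ℂ) = Fintype.card F - 2 + t := by
    push_cast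
    simp only [hr]
    simp_rw [h.card_cube_roots]
    have e1 := h.sum_apply
    have e2 := h.inv.sum_apply
    have e3 := h.sum_apply_add_one
    have e4 := h.inv.sum_apply_add_one
    have e5 := h.sum_apply_mul_apply_add_one
    have e6 := h.inv.sum_apply_mul_apply_add_one
    have e7 := h.sum_apply_mul_apply_sq (c := 0) (e := 1) zero_ne_one
    have e8 := h.sum_apply_mul_apply_sq (c := 1) (e := 0) one_ne_zero
    simp only [h.inv_apply, add_zero] at e2 e4 e6 e7 e8
    have : ∑ u, (1 + χ u + χ u ^ 2) * (1 + χ (u + 1) + χ (u + 1) ^ 2) =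
        ∑ u : F, (1 : ℂ) + ∑ u, χ u + ∑ u, χ u ^ 2 + ∑ u, χ (u + 1) + ∑ u, χ (u + 1) ^ 2 +
        ∑ u, χ u * χ (u + 1) + ∑ u, χ u ^ 2 * χ (u + 1) ^ 2 + ∑ u, χ u * χ (u + 1) ^ 2 +
        ∑ u, χ (u + 1) * χ u ^ 2 := by
      simp_rw [← sum_add_distrib]
      exact sum_congr rfl fun u _ => by ring
    rw [this, e1, e2, e3, e4, e5, e6, e7, e8, ← ht, sum_const, card_univ]
    simp
    ring
  have hZ : ((∑ u, r u * r (u + 1) : ℕ) : ℤ) = Fintype.card F - 2 + t := by exact_mod_cast hC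
  have hF : ((∑ u, r u * r (u + 1) : ℕ) : F) = -2 - (Nat.choose (2 * s) s : F) := by
    push_cast
    simp only [hr]
    simp_rw [h.card_cube_roots_cast]
    have e : ∀ u : F, (1 + u ^ s + u ^ (2 * s)) * (1 + (u + 1) ^ s + (u + 1) ^ (2 * s)) =
        ∑ a ∈ range 3, ∑ b ∈ range 3, u ^ (a * s) * (u + 1) ^ (b * s) := by
      intro u
      simp only [sum_range_succ, range_zero, sum_empty, zero_mul, one_mul, pow_zero]
      ring
    simp_rw [e]
    rw [sum_comm]
    have e2 : ∀ a ∈ range 3, ∑ u : F, ∑ b ∈ range 3, u ^ (a * s) * (u + 1) ^ (b * s) =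
        ∑ b ∈ range 3, -(Nat.choose (b * s) ((3 - a) * s) : F) := by
      intro a ha
      rw [mem_range] at ha
      rw [sum_comm]
      refine sum_congr rfl fun b hb => ?_
      rw [mem_range] at hb
      exact h.sum_pow_mul_add_one_pow (by omega) (by omega)
    rw [sum_congr rfl e2]
    simp only [sum_range_succ, range_zero, sum_empty, zero_mul, one_mul]
    rw [Nat.choose_eq_zero_of_lt (by omega : s < (3 - 0) * s),
      Nat.choose_eq_zero_of_lt (by omega : 2 * s < (3 - 0) * s),
      Nat.choose_eq_zero_of_lt (by omega : 0 < (3 - 0) * s),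
      Nat.choose_eq_zero_of_lt (by omega : 0 < (3 - 1) * s),
      Nat.choose_eq_zero_of_lt (by omega : s < (3 - 1) * s),
      Nat.choose_eq_zero_of_lt (by omega : 0 < (3 - 2) * s)]
    norm_num
    ring
  have hZF := congrArg (Int.cast : ℤ → F) hZ
  push_cast at hZF hF
  rw [hF, FiniteField.cast_card_eq_zero F] at hZF
  linear_combination -hZF

theorem not_dvd_trace (h : IsCubicCharacter s χ g) {p k : ℕ} (hp : p.Prime) (h1 : p % 3 = 1)
    (hk : Fintype.card F = p ^ k) {t : ℤ}
    (ht : jacobiSum χ χ + jacobiSum χ⁻¹ χ⁻¹ = t) : ¬ (p : ℤ) ∣ t := by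
  have hs : p ^ k = 3 * s + 1 := by rw [← hk, h.card]
  have h0 : ((p : ℕ) : F) = 0 := by
    have := FiniteField.cast_card_eq_zero F
    rw [hk, Nat.cast_pow] at this
    exact eq_zero_of_pow_eq_zero this
  have : CharP F p := by
    obtain ⟨c, hc⟩ := CharP.exists F
    rcases (Nat.dvd_prime hp).1 ((CharP.cast_eq_zero_iff F c p).1 h0) with rfl | rfl
    · exact absurd rfl (CharP.char_ne_one F 1)
    · exact hc
  rw [← CharP.intCast_eq_zero_iff F p, h.trace_cast ht, neg_eq_zero, CharP.cast_eq_zero_iff F p]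
  exact not_dvd_choose_two_mul hp h1 k s hs

end IsCubicCharacter

open Filter Topology

/-! ### Norm equations -/

/-- Multiplying by x + y gives x³ ≡ (-y)³. Cubing is injective mod p when p ≡ 2 (mod 3), so x ≡ -y
and the norm becomes 3y². -/
theorem dvd_of_dvd_norm {p : ℕ} (hp : p.Prime) (h2 : p % 3 = 2) {x y : ℤ}
    (h : (p : ℤ) ∣ x ^ 2 - x * y + y ^ 2) : (p : ℤ) ∣ x ∧ (p : ℤ) ∣ y := by
  have := Fact.mk hp
  have hcube : ∀ z : ZMod p, (z ^ 3) ^ (2 * (p / 3) + 1) = z := by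
    intro z
    rw [← pow_mul, show 3 * (2 * (p / 3) + 1) = p + (p - 1) by omega, pow_add, ZMod.pow_card,
      mul_comm, ← pow_succ, Nat.sub_add_cancel hp.one_le, ZMod.pow_card]
  rw [← ZMod.intCast_zmod_eq_zero_iff_dvd] at h
  push_cast at h
  have hxy : (x : ZMod p) = -y := by
    have h3 : (x : ZMod p) ^ 3 = (-y) ^ 3 := by linear_combination (x + y : ZMod p) * h
    rw [← hcube x, h3, hcube]
  have h3 : (3 : ZMod p) ≠ 0 := by
    intro h0
    have : p ∣ 3 := (ZMod.natCast_eq_zero_iff 3 p).1 (by exact_mod_cast h0)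
    have := Nat.le_of_dvd (by norm_num) this
    have : p = 2 := by have := hp.two_le; omega
    subst this
    omega
  have hy : (y : ZMod p) = 0 := by
    rw [hxy] at h
    have : (3 : ZMod p) * (y : ZMod p) ^ 2 = 0 := by linear_combination h
    exact eq_zero_of_pow_eq_zero ((mul_eq_zero.1 this).resolve_left h3)
  rw [hy, neg_zero] at hxy
  exact ⟨(ZMod.intCast_zmod_eq_zero_iff_dvd x p).1 hxy, (ZMod.intCast_zmod_eq_zero_iff_dvd y p).1 hy⟩

theorem exists_eq_pow_mul_of_norm {p : ℕ} (hp : p.Prime) (h2 : p % 3 = 2) (m : ℕ) {x y : ℤ}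
    (h : (p : ℤ) ^ (2 * m) = x ^ 2 - x * y + y ^ 2) :
    ∃ x' y' : ℤ, x = p ^ m * x' ∧ y = p ^ m * y' ∧ 1 = x' ^ 2 - x' * y' + y' ^ 2 := by
  induction m generalizing x y with
  | zero => exact ⟨x, y, by simp, by simp, by simpa using h⟩
  | succ m ih =>
    obtain ⟨⟨x₁, rfl⟩, ⟨y₁, rfl⟩⟩ := dvd_of_dvd_norm hp h2
      (show (p : ℤ) ∣ x ^ 2 - x * y + y ^ 2 from h ▸ dvd_pow_self _ (by omega))
    have hp0 : (p : ℤ) ^ 2 ≠ 0 := pow_ne_zero _ (by exact_mod_cast hp.ne_zero)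
    obtain ⟨x', y', rfl, rfl, e⟩ := ih (x := x₁) (y := y₁) (by
      apply mul_left_cancel₀ hp0
      rw [← pow_add, show 2 + 2 * m = 2 * (m + 1) by ring, h]
      ring)
    exact ⟨x', y', by ring, by ring, e⟩

/-- After removing p^m a unit of norm 1 remains. Its second coordinate is a multiple of 3, hence
zero, so 3d - 1 = ±p^m, and reduction mod 3 selects -(-p)^m. -/
theorem trace_eq_of_inert {p : ℕ} (hp : p.Prime) (h2 : p % 3 = 2) (m : ℕ) {d e : ℤ}
    (h : (p : ℤ) ^ (2 * m) = (3 * d - 1) ^ 2 - (3 * d - 1) * (3 * e) + (3 * e) ^ 2) :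
    2 * (3 * d - 1) - 3 * e = -2 * (-p) ^ m := by
  obtain ⟨x, y, hx, hy, h1⟩ := exists_eq_pow_mul_of_norm hp h2 m h
  have hpm : (-(p : ℤ)) ^ m ≡ 1 [ZMOD 3] := by
    have : -(p : ℤ) ≡ 1 [ZMOD 3] := by
      change -(p : ℤ) % 3 = 1 % 3
      omega
    simpa using this.pow m
  have h3y : (3 : ℤ) ∣ y := by
    have h3 : (3 : ℤ) ∣ (-(p : ℤ)) ^ m * y := by
      rcases Nat.even_or_odd m with hm | hm
      · rw [hm.neg_pow, ← hy]; exact Dvd.intro _ rfl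
      · rw [hm.neg_pow, neg_mul, ← hy, dvd_neg]; exact Dvd.intro _ rfl
    refine (Int.prime_three.dvd_mul.1 h3).resolve_left fun h4 => ?_
    have := hpm.dvd
    omega
  have hy0 : y = 0 := by
    obtain ⟨z, rfl⟩ := h3y
    have : z = 0 := by
      by_contra hz
      have : 0 < z ^ 2 := by positivity
      nlinarith [sq_nonneg (2 * x - 3 * z)]
    rw [this, mul_zero]
  subst hy0
  have he : e = 0 := by simpa using hy
  subst he
  have hx1 : x = 1 ∨ x = -1 := by
    have : (x - 1) * (x + 1) = 0 := by linear_combination -h1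
    rcases mul_eq_zero.1 this with h0 | h0 <;> omega
  rcases Nat.even_or_odd m with hm | hm
  · rw [hm.neg_pow] at hpm ⊢
    rcases hx1 with rfl | rfl
    · have := hpm.dvd
      omega
    · rw [hx]; ring
  · rw [hm.neg_pow] at hpm ⊢
    rcases hx1 with rfl | rfl
    · rw [hx]; ring
    · have := hpm.dvd
      omega

/-- The product (tv - ub)(tv + ub) is a multiple of p^k, and p cannot divide both factors, so p^k
divides one. As (tu ± 27bv)² + 27(tv ∓ ub)² = 16p^(2k) and 27 > 16, that factor is 0. -/
theorem sq_eq_sq_of_norm_eq {p k : ℕ} (hp : p.Prime) (hp2 : p ≠ 2) (hk : 0 < k)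
    {t b u v : ℤ} (h1 : 4 * (p : ℤ) ^ k = t ^ 2 + 27 * b ^ 2)
    (h2 : 4 * (p : ℤ) ^ k = u ^ 2 + 27 * v ^ 2) (ht : ¬ (p : ℤ) ∣ t) (hu : ¬ (p : ℤ) ∣ u) :
    t ^ 2 = u ^ 2 := by
  have hpz : Prime (p : ℤ) := Nat.prime_iff_prime_int.1 hp
  have hp0 : 0 < (p : ℤ) ^ k := pow_pos (by exact_mod_cast hp.pos) k
  have hpk : (p : ℤ) ∣ (p : ℤ) ^ k := dvd_pow_self _ hk.ne'
  have hmul : (p : ℤ) ^ k ∣ (t * v - u * b) * (t * v + u * b) :=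
    ⟨4 * (v ^ 2 - b ^ 2), by linear_combination -(v ^ 2) * h1 + b ^ 2 * h2⟩
  have small : ∀ y z : ℤ, y ^ 2 + 27 * z ^ 2 = 16 * ((p : ℤ) ^ k) ^ 2 → (p : ℤ) ^ k ∣ z → z = 0 := by
    rintro y z h ⟨c, rfl⟩
    by_contra hc
    have hc0 : c ≠ 0 := by rintro rfl; simp at hc
    have : 0 < c ^ 2 := by positivity
    nlinarith [sq_nonneg y, pow_pos hp0 2]
  have fin : t ^ 2 * v ^ 2 = u ^ 2 * b ^ 2 → t ^ 2 = u ^ 2 := by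
    intro h
    have : 4 * (p : ℤ) ^ k * (v ^ 2 - b ^ 2) = 0 := by
      linear_combination v ^ 2 * h1 - b ^ 2 * h2 + h
    have := (mul_eq_zero.1 this).resolve_left (by positivity)
    linear_combination h2 - h1 + 27 * this
  have hnot : ¬ ((p : ℤ) ∣ t * v - u * b ∧ (p : ℤ) ∣ t * v + u * b) := by
    rintro ⟨ha, hb⟩
    have hs : (p : ℤ) ∣ 2 * (t * v) := by
      have := dvd_add ha hb
      ring_nf at this ⊢
      exact this
    have hv : (p : ℤ) ∣ v := by
      rcases hpz.dvd_mul.1 hs with h | h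
      · exact absurd ((Nat.prime_dvd_prime_iff_eq hp Nat.prime_two).1 (by exact_mod_cast h)) hp2
      · exact (hpz.dvd_mul.1 h).resolve_left ht
    refine hu (hpz.dvd_of_dvd_pow (n := 2) ?_)
    have : u ^ 2 = 4 * (p : ℤ) ^ k - 27 * v * v := by linear_combination -h2
    rw [this]
    exact dvd_sub (hpk.mul_left _) (hv.mul_left _)
  by_cases ha : (p : ℤ) ∣ t * v - u * b
  · have hb : ¬ (p : ℤ) ∣ t * v + u * b := fun hb => hnot ⟨ha, hb⟩
    have hd := (IsCoprime.pow_left ((hpz.coprime_iff_not_dvd).2 hb)).dvd_of_dvd_mul_right hmul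
    have := small (t * u + 27 * (b * v)) _ (by linear_combination -4 * (p:ℤ)^k * h1 - (t^2 + 27*b^2) * h2) hd
    exact fin (by linear_combination (t * v + u * b) * this)
  · have hd := (IsCoprime.pow_left ((hpz.coprime_iff_not_dvd).2 ha)).dvd_of_dvd_mul_left hmul
    have := small (t * u - 27 * (b * v)) _ (by linear_combination -4 * (p:ℤ)^k * h1 - (t^2 + 27*b^2) * h2) hd
    exact fin (by linear_combination (t * v - u * b) * this)

/-! ### Lucas sequences -/

/-- The linear recurrence `u (k + 2) = A * u (k + 1) - P * u k`. -/
def lucasSequence (A P u₀ u₁ : ℤ) : ℕ → ℤ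
  | 0 => u₀
  | 1 => u₁
  | k + 2 => A * lucasSequence A P u₀ u₁ (k + 1) - P * lucasSequence A P u₀ u₁ k

theorem lucasSequence_eq {A P u₀ u₁ : ℤ} {α β a b : ℂ} (hA : α + β = A) (hP : α * β = P)
    (h0 : a + b = u₀) (h1 : a * α + b * β = u₁) (k : ℕ) :
    (lucasSequence A P u₀ u₁ k : ℂ) = a * α ^ k + b * β ^ k := by
  induction k using Nat.twoStepInduction with
  | zero => simp [lucasSequence, h0]
  | one => simp [lucasSequence, h1]
  | more k ih1 ih2 =>
    rw [lucasSequence]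
    push_cast
    rw [ih1, ih2, ← hA, ← hP]
    ring

theorem lucasSequence_modEq {A P : ℤ} (k : ℕ) :
    lucasSequence A P 2 A (k + 1) ≡ A ^ (k + 1) [ZMOD P] := by
  induction k with
  | zero => simp [lucasSequence]
  | succ k ih =>
    rw [lucasSequence, pow_succ' A (k + 1)]
    have := (ih.mul_left A).sub (Int.modEq_zero_iff_dvd.2
      (dvd_mul_right P (lucasSequence A P 2 A k)))
    simpa using this

/-- Used to fix the sign of the trace: the recurrence mod 3 reads 2·2 - 1·2 = 2. -/
theorem lucasSequence_emod_three {A P : ℤ} (hA : A % 3 = 2) (hP : P % 3 = 1) (k : ℕ) :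
    lucasSequence A P 2 A k % 3 = 2 := by
  induction k using Nat.twoStepInduction with
  | zero => simp [lucasSequence]
  | one => simpa [lucasSequence] using hA
  | more k ih1 ih2 =>
    rw [lucasSequence, Int.sub_emod, Int.mul_emod, Int.mul_emod P, hA, hP, ih1, ih2]
    norm_num

/-! ### Powers of a point of the circle -/

/-- As u is not a root of unity, u^L generates a dense subgroup; its natural powers therefore
accumulate everywhere, in particular at u⁻¹c. -/
theorem Circle.frequently_norm_pow_sub_lt {u : Circle} (hu : ∀ m : ℕ, 0 < m → u ^ m ≠ 1) {L : ℕ}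
    (hL : 0 < L) (c : Circle) {δ : ℝ} (hδ : 0 < δ) :
    ∃ᶠ j : ℕ in atTop, ‖(u : ℂ) ^ (1 + L * j) - c‖ < δ := by
  have hdense : Dense (Subgroup.zpowers (u ^ L) : Set Circle) := by
    have : Fact ((0 : ℝ) < 1) := ⟨one_pos⟩
    let e := AddCircle.homeomorphCircle (one_ne_zero (α := ℝ))
    have hd : DenseRange (· • e.symm (u ^ L) : ℤ → AddCircle (1 : ℝ)) := by
      rw [AddCircle.denseRange_zsmul_iff, addOrderOf_eq_zero_iff, isOfFinAddOrder_iff_nsmul_eq_zero]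
      rintro ⟨m, hm, h0⟩
      have := AddCircle.toCircle_nsmul (e.symm (u ^ L)) m
      rw [h0, AddCircle.toCircle_zero, ← AddCircle.homeomorphCircle_apply (one_ne_zero (α := ℝ)),
        Homeomorph.apply_symm_apply, ← pow_mul] at this
      exact hu _ (Nat.mul_pos hL hm) this.symm
    have := e.surjective.denseRange.comp hd e.continuous
    rw [Subgroup.coe_zpowers]
    rw [DenseRange] at this
    convert this using 3 with n
    simp only [Function.comp_apply]
    rw [AddCircle.homeomorphCircle_apply, AddCircle.toCircle_zsmul,
      ← AddCircle.homeomorphCircle_apply (one_ne_zero (α := ℝ)), Homeomorph.apply_symm_apply]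
  have hcl : MapClusterPt (u⁻¹ * c) atTop ((u ^ L) ^ · : ℕ → Circle) := by
    rw [mapClusterPt_atTop_pow_iff_mem_topologicalClosure_zpowers]
    exact hdense _
  have hU : {y : Circle | ‖((u * y : Circle) : ℂ) - c‖ < δ} ∈ 𝓝 (u⁻¹ * c) := by
    refine IsOpen.mem_nhds (isOpen_lt (by fun_prop) continuous_const) ?_
    simpa using hδ
  refine (hcl.frequently hU).mono fun j hj => ?_
  have e : ((u * (u ^ L) ^ j : Circle) : ℂ) = (u : ℂ) ^ (1 + L * j) := by
    push_cast
    rw [pow_add, pow_one, pow_mul]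
  rw [← e]
  exact hj

theorem frequently_lucasSequence {p : ℕ} (hp : p.Prime) {A e : ℤ}
    (h : 4 * (p : ℤ) = A ^ 2 + 27 * e ^ 2) (hA : ¬ (p : ℤ) ∣ A) {L : ℕ} (hL : 0 < L)
    {σ : ℝ} (hσ : σ = 1 ∨ σ = -1) {δ : ℝ} (hδ : 0 < δ) :
    ∃ᶠ j : ℕ in atTop, (2 - δ) * √((p : ℝ) ^ (1 + L * j)) <
      σ * lucasSequence A p 2 A (1 + L * j) := by
  have hp0 : (0 : ℝ) < p := by exact_mod_cast hp.pos
  have hr : 0 < √(p : ℝ) := Real.sqrt_pos.2 hp0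
  have hr2 : √(p : ℝ) ^ 2 = p := Real.sq_sqrt hp0.le
  have h27 : √(27 : ℝ) ^ 2 = 27 := Real.sq_sqrt (by norm_num)
  have hR : 4 * (p : ℝ) = A ^ 2 + 27 * e ^ 2 := by exact_mod_cast h
  -- A root of X² - AX + p, of discriminant -27e², scaled to the unit circle.
  set w : ℂ := ⟨A / (2 * √p), √27 * e / (2 * √p)⟩ with hw
  have hnorm : w * (starRingEnd ℂ) w = 1 := by
    rw [Complex.mul_conj, Complex.normSq_apply]
    have : (A / (2 * √p) * (A / (2 * √p)) + √27 * e / (2 * √p) * (√27 * e / (2 * √p)) : ℝ) = 1 := by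
      field_simp
      rw [h27, hr2]
      linarith
    exact_mod_cast this
  have hsum : √(p : ℝ) * w + √(p : ℝ) * (starRingEnd ℂ) w = (A : ℂ) := by
    rw [← mul_add, Complex.add_conj]
    have : √(p : ℝ) * (2 * (A / (2 * √p))) = A := by field_simp
    exact_mod_cast this
  have hprod : √(p : ℝ) * w * (√(p : ℝ) * (starRingEnd ℂ) w) = ((p : ℤ) : ℂ) := by
    have : ((√(p : ℝ) : ℝ) : ℂ) ^ 2 = p := by exact_mod_cast congrArg Complex.ofReal hr2
    push_cast
    linear_combination ((√(p : ℝ) : ℝ) : ℂ) ^ 2 * hnorm + this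
  have hV : ∀ k, (lucasSequence A p 2 A k : ℝ) = 2 * (√p ^ k * (w ^ k).re) := by
    intro k
    have h1 := lucasSequence_eq (a := 1) (b := 1) (u₀ := 2) (u₁ := A) hsum hprod (by norm_num)
      (by rw [one_mul, one_mul, hsum]) k
    rw [one_mul, one_mul, mul_pow, mul_pow, ← map_pow, ← mul_add, Complex.add_conj] at h1
    have h2 : ((lucasSequence A p 2 A k : ℝ) : ℂ) = ((√p ^ k * (2 * (w ^ k).re) : ℝ) : ℂ) := by
      push_cast at h1 ⊢
      exact h1
    rw [Complex.ofReal_inj.1 h2]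
    ring
  have hw1 : w ∈ Submonoid.unitSphere ℂ := by
    refine mem_sphere_zero_iff_norm.2 ?_
    have h1 : ‖w‖ ^ 2 = 1 := by
      rw [← Complex.normSq_eq_norm_sq]
      rw [Complex.mul_conj] at hnorm
      exact_mod_cast hnorm
    exact (pow_eq_one_iff_of_nonneg (norm_nonneg w) two_ne_zero).1 h1
  let u : Circle := ⟨w, hw1⟩
  -- If w^m = 1, the m-th term V satisfies V² = 4p^m, so p divides V; but V ≡ A^m mod p.
  have hu : ∀ m : ℕ, 0 < m → u ^ m ≠ 1 := by
    intro m hm h1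
    have hwm : w ^ m = 1 := by
      have := congrArg (Subtype.val : Circle → ℂ) h1
      simpa using this
    have h2 := hV m
    rw [hwm, Complex.one_re, mul_one] at h2
    have h3 : (lucasSequence A p 2 A m) ^ 2 = 4 * (p : ℤ) ^ m := by
      have : (lucasSequence A p 2 A m : ℝ) ^ 2 = 4 * (p : ℝ) ^ m := by
        rw [h2, mul_pow, ← pow_mul, mul_comm m 2, pow_mul, hr2]
        norm_num
      exact_mod_cast this
    have hpz : Prime (p : ℤ) := Nat.prime_iff_prime_int.1 hp
    have h4 : (p : ℤ) ∣ lucasSequence A p 2 A m := by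
      refine hpz.dvd_of_dvd_pow (n := 2) ?_
      rw [h3]
      exact (dvd_pow_self _ hm.ne').mul_left _
    obtain ⟨k, rfl⟩ : ∃ k, m = k + 1 := ⟨m - 1, by omega⟩
    have h5 := (lucasSequence_modEq (A := A) (P := p) k).dvd_iff
    exact hA (hpz.dvd_of_dvd_pow (h5.1 h4))
  obtain ⟨c, hc⟩ : ∃ c : Circle, (c : ℂ) = (σ : ℂ) := by
    refine ⟨⟨σ, ?_⟩, rfl⟩
    refine mem_sphere_zero_iff_norm.2 ?_
    rcases hσ with rfl | rfl <;> simp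
  refine (Circle.frequently_norm_pow_sub_lt hu hL c (half_pos hδ)).mono fun j hj => ?_
  rw [hc] at hj
  have h1 := (Complex.abs_re_le_norm _).trans_lt hj
  rw [Complex.sub_re, Complex.ofReal_re, abs_lt] at h1
  change -(δ / 2) < (w ^ (1 + L * j)).re - σ ∧ (w ^ (1 + L * j)).re - σ < δ / 2 at h1
  have hs : √((p : ℝ) ^ (1 + L * j)) = √(p : ℝ) ^ (1 + L * j) := by
    rw [Real.sqrt_eq_iff_eq_sq (by positivity) (by positivity), ← pow_mul, mul_comm (1 + L * j),
      pow_mul, hr2]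
  rw [hs, hV]
  have hk : 0 < √(p : ℝ) ^ (1 + L * j) := pow_pos hr _
  generalize (w ^ (1 + L * j)).re = x at *
  have : 2 - δ < σ * (2 * x) := by
    rcases hσ with rfl | rfl <;> linarith
  calc (2 - δ) * √(p : ℝ) ^ (1 + L * j) < σ * (2 * x) * √(p : ℝ) ^ (1 + L * j) :=
        mul_lt_mul_of_pos_right this hk
    _ = _ := by ring

/-! ### Admissible exponents -/

/-- A prime r dividing n and (Q^m - 1)/3 gives Q^m ≡ 1 mod 3r. Since φ(3r) divides φ(3n), hence m -
1, already Q ≡ 1 mod 3r. Working mod 3r rather than r also covers r = 3. -/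
theorem coprime_pow_mul_sub_one_div {n Q m : ℕ} (hQ : Q % 3 = 1) (hm : 0 < m)
    (h : Nat.gcd n ((Q - 1) / 3) = 1) (hφ : (3 * n).totient ∣ m - 1) :
    Nat.gcd n ((Q ^ m - 1) / 3) = 1 := by
  by_contra hne
  obtain ⟨r, hr, hrd⟩ := Nat.exists_prime_and_dvd hne
  have hrn : r ∣ n := hrd.trans (Nat.gcd_dvd_left _ _)
  have hrs : r ∣ (Q ^ m - 1) / 3 := hrd.trans (Nat.gcd_dvd_right _ _)
  have hQm : Q ^ m % 3 = 1 := by rw [Nat.pow_mod, hQ]; simp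
  have h3 : 3 * r ∣ Q ^ m - 1 := by
    have := Nat.mul_dvd_mul_left 3 hrs
    rwa [Nat.mul_div_cancel' (by omega : 3 ∣ Q ^ m - 1)] at this
  have hmod : Q ^ m ≡ 1 [MOD 3 * r] := ((Nat.modEq_iff_dvd' (by omega)).2 h3).symm
  have hcop : Nat.Coprime Q (3 * r) := by
    have : Nat.Coprime (Q ^ m) (3 * r) := by
      rw [Nat.Coprime, hmod.gcd_eq, Nat.gcd_one_left]
    exact (Nat.coprime_pow_left_iff hm _ _).1 this
  obtain ⟨c, hc⟩ := (Nat.totient_dvd_of_dvd (Nat.mul_dvd_mul_left 3 hrn)).trans hφ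
  have hQ1 : Q ≡ 1 [MOD 3 * r] := by
    have h1 := (Nat.ModEq.pow_totient hcop).pow c
    rw [one_pow, ← pow_mul, ← hc] at h1
    have h2 := h1.mul_right Q
    rw [← pow_succ, Nat.sub_add_cancel hm, one_mul] at h2
    exact h2.symm.trans hmod
  have h4 : 3 * r ∣ Q - 1 := (Nat.modEq_iff_dvd' (by omega)).1 hQ1.symm
  have h5 : r ∣ (Q - 1) / 3 := by
    obtain ⟨c, hc⟩ := h4
    exact ⟨c, by rw [hc, mul_assoc, Nat.mul_div_cancel_left _ (by norm_num)]⟩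
  have h6 := Nat.dvd_gcd hrn h5
  rw [h] at h6
  exact hr.one_lt.ne' (Nat.dvd_one.1 h6)

theorem Admissible.mul {p n k : ℕ} (h : Admissible p n k) (j : ℕ) :
    Admissible p n (k * (1 + (3 * n).totient * j)) := by
  obtain ⟨hk, h3, hg⟩ := h
  refine ⟨by positivity, ?_, ?_⟩
  · rw [pow_mul]
    simpa using h3.pow (1 + (3 * n).totient * j)
  · rw [pow_mul]
    exact coprime_pow_mul_sub_one_div h3 (by omega) hg (by simp)

theorem Admissible.of_dvd {p n k d : ℕ} (h : Admissible p n k) (hdk : d ∣ k)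
    (h3 : p ^ d ≡ 1 [MOD 3]) : Admissible p n d := by
  obtain ⟨hk, h3k, hg⟩ := h
  refine ⟨Nat.pos_of_dvd_of_pos hdk hk, h3, ?_⟩
  have hd : (p ^ d - 1) ∣ p ^ k - 1 := by
    obtain ⟨c, rfl⟩ := hdk
    rw [pow_mul]
    simpa using Nat.sub_dvd_pow_sub_pow (p ^ d) 1 c
  have h3' : p ^ d % 3 = 1 := h3
  exact Nat.Coprime.coprime_dvd_right (Nat.div_dvd_div (by omega) hd) hg

/-! ### The field with `p ^ k` elements -/

/-- The trace of the cubic Jacobi sums over a field with `q` elements determines the number of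
permutation binomials. -/
structure IsCubicTrace (F : Type*) [Field F] (p q : ℕ) (t : ℤ) : Prop where
  norm : ∃ d e : ℤ, t = 2 * (3 * d - 1) - 3 * e ∧
    (q : ℤ) = (3 * d - 1) ^ 2 - (3 * d - 1) * (3 * e) + (3 * e) ^ 2
  not_dvd : p % 3 = 1 → ¬ (p : ℤ) ∣ t
  count : ∀ n : ℕ, 0 < n → Nat.gcd n ((q - 1) / 3) = 1 →
    (9 * permBinomialCount F n : ℤ) = 2 * q + 2 * t - 7 ∨
      (9 * permBinomialCount F n : ℤ) = 2 * q + 2 * t - 16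
  count_eq_zero : ∀ n : ℕ, Nat.gcd n ((q - 1) / 3) ≠ 1 → permBinomialCount F n = 0

theorem exists_isCubicTrace (F : Type*) [Field F] {p k : ℕ} (hp : p.Prime)
    (hF : Nat.card F = p ^ k) (h3 : p ^ k % 3 = 1) : ∃ t : ℤ, IsCubicTrace F p (p ^ k) t := by
  have : Finite F := Nat.finite_of_card_ne_zero (by rw [hF]; exact pow_ne_zero _ hp.ne_zero)
  have := Fintype.ofFinite F
  rw [Nat.card_eq_fintype_card] at hF
  obtain ⟨s, hs⟩ : ∃ s, p ^ k = 3 * s + 1 := ⟨p ^ k / 3, by omega⟩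
  obtain ⟨χ, g, h⟩ := exists_isCubicCharacter F (hF.trans hs)
  obtain ⟨d, e, h1, h2⟩ := h.exists_trace
  have hs' : (p ^ k - 1) / 3 = s := by omega
  refine ⟨_, ⟨d, e, rfl, ?_⟩, fun hp1 => h.not_dvd_trace hp hp1 hF h2, ?_, ?_⟩
  · rw [← h1, hF]
  · intro n hn hg
    rw [hs'] at hg
    have := h.nine_mul_permBinomialCount hn hg h2
    rwa [hF] at this
  · intro n hg
    rw [hs'] at hg
    exact h.permBinomialCount_eq_zero hg

namespace IsCubicTrace

variable {F : Type*} [Field F] {p q : ℕ} {t : ℤ}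

theorem norm_eq (h : IsCubicTrace F p q t) : ∃ b : ℤ, 4 * (q : ℤ) = t ^ 2 + 27 * b ^ 2 := by
  obtain ⟨d, e, rfl, h1⟩ := h.norm
  exact ⟨e, by rw [h1]; ring⟩

theorem emod_three (h : IsCubicTrace F p q t) : t % 3 = 1 := by
  obtain ⟨d, e, rfl, -⟩ := h.norm
  omega

theorem abs_le (h : IsCubicTrace F p q t) : |(t : ℝ)| ≤ 2 * √(q : ℝ) := by
  obtain ⟨b, hb⟩ := h.norm_eq
  have h1 : (4 * q : ℝ) = t ^ 2 + 27 * b ^ 2 := by exact_mod_cast hb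
  refine abs_le_of_sq_le_sq ?_ (by positivity)
  rw [mul_pow, Real.sq_sqrt (by positivity)]
  nlinarith [sq_nonneg (b : ℝ)]

/-- For `p ≡ 1 (mod 3)` the traces over the extensions of the prime field form, up to sign,
a Lucas sequence. -/
theorem eq_neg_lucasSequence {E : Type*} [Field E] {k : ℕ} {t₁ : ℤ} (hp : p.Prime)
    (hp1 : p % 3 = 1) (hk : 0 < k) (h₁ : IsCubicTrace E p p t₁) (h : IsCubicTrace F p (p ^ k) t) :
    t = -lucasSequence (-t₁) p 2 (-t₁) k := by
  obtain ⟨e, he⟩ := h₁.norm_eq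
  obtain ⟨b, hb⟩ := h.norm_eq
  push_cast at hb
  set V := lucasSequence (-t₁) p 2 (-t₁) with hV
  set W := lucasSequence (-t₁) p 0 e with hW
  -- V = α^k + β^k and rW = α^k - β^k with r² = -27, so V² + 27W² = 4(αβ)^k.
  have hnorm : 4 * (p : ℤ) ^ k = V k ^ 2 + 27 * W k ^ 2 := by
    obtain ⟨r, hr⟩ : ∃ r : ℂ, r ^ 2 = -27 := IsAlgClosed.exists_pow_nat_eq _ (by norm_num)
    have hr0 : r ≠ 0 := by rintro rfl; norm_num at hr
    have heC : 4 * (p : ℂ) = t₁ ^ 2 + 27 * e ^ 2 := by exact_mod_cast he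
    set α : ℂ := (-t₁ + r * e) / 2 with hα
    set β : ℂ := (-t₁ - r * e) / 2 with hβ
    have hs : α + β = ((-t₁ : ℤ) : ℂ) := by rw [hα, hβ]; push_cast; ring
    have hm : α * β = ((p : ℤ) : ℂ) := by
      rw [hα, hβ]; push_cast
      linear_combination -heC / 4 - (e : ℂ) ^ 2 / 4 * hr
    have e1 := lucasSequence_eq (a := 1) (b := 1) (u₀ := 2) (u₁ := -t₁) hs hm (by norm_num)
      (by rw [one_mul, one_mul, hs]) k
    have e2 := lucasSequence_eq (a := 1 / r) (b := -1 / r) (u₀ := 0) (u₁ := e) hs hm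
      (by push_cast; ring) (by rw [hα, hβ]; field_simp; ring) k
    have e3 : r * (W k : ℂ) = α ^ k - β ^ k := by rw [hW, e2]; field_simp; ring
    have e4 : (V k : ℂ) = α ^ k + β ^ k := by rw [hV, e1, one_mul, one_mul]
    have e5 : (α ^ k) * (β ^ k) = (p : ℂ) ^ k := by rw [← mul_pow, hm]; norm_cast
    have : (4 * (p : ℂ) ^ k) = (V k : ℂ) ^ 2 + 27 * (W k : ℂ) ^ 2 := by
      rw [← e5, e4]
      linear_combination -(W k : ℂ) ^ 2 * hr + (r * (W k : ℂ) + (α ^ k - β ^ k)) * e3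
    exact_mod_cast this
  have hpz : Prime (p : ℤ) := Nat.prime_iff_prime_int.1 hp
  have hVp : ¬ (p : ℤ) ∣ V k := by
    obtain ⟨m, rfl⟩ : ∃ m, k = m + 1 := ⟨k - 1, by omega⟩
    rw [hV, (lucasSequence_modEq (A := -t₁) (P := p) m).dvd_iff]
    intro hd
    exact h₁.not_dvd hp1 ((dvd_neg).1 (hpz.dvd_of_dvd_pow hd))
  have hsq := sq_eq_sq_of_norm_eq hp (by rintro rfl; omega) hk hb hnorm (h.not_dvd hp1) hVp
  have ht := h.emod_three
  have ht1 := h₁.emod_three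
  have hV3 : V k % 3 = 2 := lucasSequence_emod_three (by omega) (by omega) k
  rcases sq_eq_sq_iff_eq_or_eq_neg.1 hsq with h0 | h0
  · omega
  · exact h0

/-- For `p ≡ 2 (mod 3)` the curve is supersingular and the trace is explicit. -/
theorem eq_of_inert {m : ℕ} (hp : p.Prime) (hp2 : p % 3 = 2)
    (h : IsCubicTrace F p (p ^ (2 * m)) t) : t = -2 * (-p) ^ m := by
  obtain ⟨d, e, rfl, h1⟩ := h.norm
  exact trace_eq_of_inert hp hp2 m (by rw [← h1]; push_cast; rfl)

end IsCubicTrace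

namespace IsCubicTrace

variable {F : Type*} [Field F] {q : ℕ} {p k n : ℕ} {t : ℤ}

theorem count_le (h : IsCubicTrace F p q t) (hn : 0 < n) (hg : Nat.gcd n ((q - 1) / 3) = 1) :
    (9 * permBinomialCount F n : ℝ) ≤ 2 * q + 2 * t - 7 := by
  have : (9 * permBinomialCount F n : ℤ) ≤ 2 * q + 2 * t - 7 := by
    rcases h.count n hn hg with e | e <;> omega
  exact_mod_cast this

theorem le_count (h : IsCubicTrace F p q t) (hn : 0 < n) (hg : Nat.gcd n ((q - 1) / 3) = 1) :
    (2 * q + 2 * t - 16 : ℝ) ≤ 9 * permBinomialCount F n := by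
  have : (2 * q + 2 * t - 16 : ℤ) ≤ 9 * permBinomialCount F n := by
    rcases h.count n hn hg with e | e <;> omega
  exact_mod_cast this

end IsCubicTrace

/-! ### Extremal traces along admissible exponents, and the resulting counts. -/

theorem sqrt_pow_two_mul (p m : ℕ) : √((p : ℝ) ^ (2 * m)) = (p : ℝ) ^ m := by
  rw [mul_comm, pow_mul, Real.sqrt_sq (by positivity)]

theorem mod_three_of_pow {p k : ℕ} (hk : 0 < k) (h : p ^ k ≡ 1 [MOD 3]) :
    p % 3 = 1 ∨ p % 3 = 2 ∧ Even k := by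
  have h' : p ^ k % 3 = 1 := h
  have : p % 3 = 0 ∨ p % 3 = 1 ∨ p % 3 = 2 := by omega
  rcases this with h0 | h0 | h0
  · rw [Nat.pow_mod, h0, zero_pow hk.ne'] at h'
    simp at h'
  · exact Or.inl h0
  · refine Or.inr ⟨h0, ?_⟩
    rw [← Nat.not_odd_iff_even]
    rintro ⟨m, rfl⟩
    rw [pow_succ, pow_mul, Nat.mul_mod, Nat.pow_mod, Nat.pow_mod p, h0] at h'
    norm_num at h'

section

variable {p n : ℕ} {F : ℕ → Type*} [∀ k, Field (F k)]

theorem exists_trace_family (hp : p.Prime) (hF : ∀ k, 0 < k → Nat.card (F k) = p ^ k) :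
    ∃ t : ℕ → ℤ, ∀ k, 0 < k → p ^ k ≡ 1 [MOD 3] → IsCubicTrace (F k) p (p ^ k) (t k) := by
  have : ∀ k, ∃ t : ℤ, 0 < k → p ^ k ≡ 1 [MOD 3] → IsCubicTrace (F k) p (p ^ k) t := by
    intro k
    by_cases hk : 0 < k ∧ p ^ k ≡ 1 [MOD 3]
    · obtain ⟨t, ht⟩ := exists_isCubicTrace (F k) hp (hF k hk.1) hk.2
      exact ⟨t, fun _ _ => ht⟩
    · exact ⟨0, fun h1 h2 => absurd ⟨h1, h2⟩ hk⟩
  exact ⟨fun k => (this k).choose, fun k => (this k).choose_spec⟩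

variable {t : ℕ → ℤ}

theorem tendsto_mul_one_add_mul {a L : ℕ} (ha : 0 < a) (hL : 0 < L) :
    Tendsto (fun j : ℕ => a * (1 + L * j)) atTop atTop := by
  refine tendsto_atTop_mono (fun j => ?_) tendsto_id
  have h1 : j ≤ L * j := Nat.le_mul_of_pos_left j hL
  have h2 : 1 + L * j ≤ a * (1 + L * j) := Nat.le_mul_of_pos_left _ ha
  simp only [id]
  omega

theorem even_totient_three_mul (hn : 0 < n) : Even (3 * n).totient :=
  Nat.totient_even (by omega)

/-- In the split case the normalized traces come arbitrarily close to both `2` and `-2`. -/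
theorem frequently_trace_of_split (hp : p.Prime) (hn : 0 < n) (hp1 : p % 3 = 1)
    (ht : ∀ k, 0 < k → p ^ k ≡ 1 [MOD 3] → IsCubicTrace (F k) p (p ^ k) (t k))
    (h1 : Admissible p n 1) {σ : ℝ} (hσ : σ = 1 ∨ σ = -1) {δ : ℝ} (hδ : 0 < δ) :
    ∃ᶠ k : ℕ in atTop, Admissible p n k ∧ (2 - δ) * √((p : ℝ) ^ k) < σ * t k := by
  have hL : 0 < (3 * n).totient := Nat.totient_pos.2 (by omega)
  have ht1 : IsCubicTrace (F 1) p p (t 1) := by simpa using ht 1 one_pos h1.2.1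
  obtain ⟨e, he⟩ := ht1.norm_eq
  have hfreq := frequently_lucasSequence hp (A := -t 1) (e := e) (by rw [he]; ring)
    (by rw [dvd_neg]; exact ht1.not_dvd hp1) hL (σ := -σ)
    (by rcases hσ with rfl | rfl <;> simp) hδ
  have htend := tendsto_mul_one_add_mul (a := 1) one_pos hL
  refine htend.frequently (hfreq.mono fun j hj => ?_)
  have hadm := h1.mul j
  refine ⟨hadm, ?_⟩
  rw [one_mul] at hadm ⊢
  rw [ht1.eq_neg_lucasSequence hp hp1 hadm.1 (ht _ hadm.1 hadm.2.1)]
  push_cast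
  linarith

/-- In the inert case 2 is admissible, and k = 2m with m = 1 + φ(3n)j, odd because φ(3n) is even,
gives t = 2√q exactly. -/
theorem frequently_trace_pos (hp : p.Prime) (hn : 0 < n)
    (ht : ∀ k, 0 < k → p ^ k ≡ 1 [MOD 3] → IsCubicTrace (F k) p (p ^ k) (t k))
    {k₀ : ℕ} (h₀ : Admissible p n k₀) {δ : ℝ} (hδ : 0 < δ) :
    ∃ᶠ k : ℕ in atTop, Admissible p n k ∧ (2 - δ) * √((p : ℝ) ^ k) < t k := by
  rcases mod_three_of_pow h₀.1 h₀.2.1 with hp1 | ⟨hp2, heven⟩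
  · have h1 : Admissible p n 1 := h₀.of_dvd (one_dvd _) (by rw [pow_one]; exact hp1)
    simpa using frequently_trace_of_split hp hn hp1 ht h1 (Or.inl rfl) hδ
  · have h2 : Admissible p n 2 := h₀.of_dvd heven.two_dvd (by
      change p ^ 2 % 3 = 1
      rw [Nat.pow_mod, hp2])
    refine (tendsto_mul_one_add_mul two_pos
      (Nat.totient_pos.2 (by omega : 0 < 3 * n))).frequently (Frequently.of_forall fun j => ?_)
    have hadm := h2.mul j
    refine ⟨hadm, ?_⟩
    have hodd : Odd (1 + (3 * n).totient * j) :=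
      Odd.add_even odd_one ((even_totient_three_mul hn).mul_right j)
    rw [(ht _ hadm.1 hadm.2.1).eq_of_inert hp hp2, sqrt_pow_two_mul, hodd.neg_pow]
    have : (0 : ℝ) < (p : ℝ) ^ (1 + (3 * n).totient * j) :=
      pow_pos (by exact_mod_cast hp.pos) _
    push_cast
    nlinarith

theorem trace_of_four_mul (hp : p.Prime) (hp2 : p % 3 = 2) {j : ℕ} {s : ℤ} {E : Type*} [Field E]
    (h : IsCubicTrace E p (p ^ (4 * j)) s) : (s : ℝ) = -2 * √((p : ℝ) ^ (4 * j)) := by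
  have e : 4 * j = 2 * (2 * j) := by ring
  rw [e] at h ⊢
  rw [h.eq_of_inert hp hp2, sqrt_pow_two_mul, (even_two_mul j).neg_pow]
  push_cast
  ring

/-- In the inert case t = -2√q requires k/2 even, hence the divisibility by 4; admissibility then
descends to the exponent 4. -/
theorem frequently_trace_neg (hp : p.Prime) (hn : 0 < n)
    (ht : ∀ k, 0 < k → p ^ k ≡ 1 [MOD 3] → IsCubicTrace (F k) p (p ^ k) (t k))
    {k₀ : ℕ} (h₀ : Admissible p n k₀) (h : p % 3 = 1 ∨ 4 ∣ k₀) {δ : ℝ} (hδ : 0 < δ) :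
    ∃ᶠ k : ℕ in atTop, Admissible p n k ∧ (t k : ℝ) < -((2 - δ) * √((p : ℝ) ^ k)) := by
  rcases mod_three_of_pow h₀.1 h₀.2.1 with hp1 | ⟨hp2, -⟩
  · have h1 : Admissible p n 1 := h₀.of_dvd (one_dvd _) (by rw [pow_one]; exact hp1)
    refine (frequently_trace_of_split hp hn hp1 ht h1 (Or.inr rfl) hδ).mono fun k hk => ⟨hk.1, ?_⟩
    linarith [hk.2]
  · have h4 : Admissible p n 4 := h₀.of_dvd (h.resolve_left (by omega)) (by
      change p ^ 4 % 3 = 1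
      rw [Nat.pow_mod, hp2])
    refine (tendsto_mul_one_add_mul four_pos
      (Nat.totient_pos.2 (by omega : 0 < 3 * n))).frequently (Frequently.of_forall fun j => ?_)
    have hadm := h4.mul j
    refine ⟨hadm, ?_⟩
    rw [trace_of_four_mul hp hp2 (ht _ hadm.1 hadm.2.1)]
    have : 0 < √((p : ℝ) ^ (4 * (1 + (3 * n).totient * j))) :=
      Real.sqrt_pos.2 (pow_pos (by exact_mod_cast hp.pos) _)
    nlinarith

theorem tendsto_sqrt_pow (hp : p.Prime) : Tendsto (fun k : ℕ => √((p : ℝ) ^ k)) atTop atTop :=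
  Real.tendsto_sqrt_atTop.comp
    (tendsto_pow_atTop_atTop_of_one_lt (by exact_mod_cast hp.one_lt))

theorem infinite_count_gt (hp : p.Prime) (hn : 0 < n)
    (ht : ∀ k, 0 < k → p ^ k ≡ 1 [MOD 3] → IsCubicTrace (F k) p (p ^ k) (t k))
    {k₀ : ℕ} (h₀ : Admissible p n k₀) {ε : ℝ} (hε : 0 < ε) :
    {k : ℕ | Admissible p n k ∧ (permBinomialCount (F k) n : ℝ) >
      2 / 9 * (p : ℝ) ^ k + (4 / 9 - ε) * √((p : ℝ) ^ k)}.Infinite := by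
  rw [← Nat.frequently_atTop_iff_infinite]
  -- The slack in ε√q has to absorb the constant -16 of the lower bound for 9T.
  have hlarge : ∀ᶠ k : ℕ in atTop, 16 / ε ≤ √((p : ℝ) ^ k) :=
    (tendsto_sqrt_pow hp).eventually_ge_atTop _
  refine ((frequently_trace_pos hp hn ht h₀ hε).and_eventually hlarge).mono ?_
  rintro k ⟨⟨hadm, hk⟩, hl⟩
  refine ⟨hadm, ?_⟩
  have h1 := (ht k hadm.1 hadm.2.1).le_count hn hadm.2.2
  rw [div_le_iff₀ hε] at hl
  push_cast at h1
  nlinarith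

theorem infinite_count_lt (hp : p.Prime) (hn : 0 < n)
    (ht : ∀ k, 0 < k → p ^ k ≡ 1 [MOD 3] → IsCubicTrace (F k) p (p ^ k) (t k))
    {k₀ : ℕ} (h₀ : Admissible p n k₀) (h : p % 3 = 1 ∨ 4 ∣ k₀) {ε : ℝ} (hε : 0 < ε) :
    {k : ℕ | Admissible p n k ∧ (permBinomialCount (F k) n : ℝ) <
      2 / 9 * (p : ℝ) ^ k - (4 / 9 - ε) * √((p : ℝ) ^ k)}.Infinite := by
  rw [← Nat.frequently_atTop_iff_infinite]
  refine (frequently_trace_neg hp hn ht h₀ h hε).mono ?_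
  rintro k ⟨hadm, hk⟩
  refine ⟨hadm, ?_⟩
  have h1 := (ht k hadm.1 hadm.2.1).count_le hn hadm.2.2
  have h2 : 0 ≤ √((p : ℝ) ^ k) := Real.sqrt_nonneg _
  push_cast at h1
  nlinarith

/-- All multiples of 4 serve: if the gcd is 1 then t = -2√q, and otherwise T = 0, which suffices
because √q ≥ 2. -/
theorem infinite_count_lt_of_inert (hp : p.Prime) (hn : 0 < n)
    (ht : ∀ k, 0 < k → p ^ k ≡ 1 [MOD 3] → IsCubicTrace (F k) p (p ^ k) (t k))
    (hp2 : p % 3 = 2) {ε : ℝ} (hε : 0 < ε) :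
    {k : ℕ | 0 < k ∧ p ^ k ≡ 1 [MOD 3] ∧ (permBinomialCount (F k) n : ℝ) <
      2 / 9 * (p : ℝ) ^ k - (4 / 9 - ε) * √((p : ℝ) ^ k)}.Infinite := by
  rw [← Nat.frequently_atTop_iff_infinite]
  refine (tendsto_mul_one_add_mul four_pos one_pos).frequently (Frequently.of_forall fun j => ?_)
  have hk : 0 < 4 * (1 + 1 * j) := by omega
  have h3 : p ^ (4 * (1 + 1 * j)) ≡ 1 [MOD 3] := by
    rw [pow_mul]
    have : p ^ 4 ≡ 1 [MOD 3] := by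
      change p ^ 4 % 3 = 1
      rw [Nat.pow_mod, hp2]
    simpa using this.pow (1 + 1 * j)
  refine ⟨hk, h3, ?_⟩
  have h := ht _ hk h3
  have h4 : √((p : ℝ) ^ (4 * (1 + 1 * j))) ^ 2 = (p : ℝ) ^ (4 * (1 + 1 * j)) :=
    Real.sq_sqrt (by positivity)
  have h5 : (2 : ℝ) ≤ √((p : ℝ) ^ (4 * (1 + 1 * j))) := by
    rw [show 4 * (1 + 1 * j) = 2 * (2 * (1 + 1 * j)) by ring, sqrt_pow_two_mul]
    calc (2 : ℝ) ≤ p := by exact_mod_cast hp.two_le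
      _ ≤ (p : ℝ) ^ (2 * (1 + 1 * j)) :=
        le_self_pow₀ (by exact_mod_cast hp.one_le) (by omega)
  by_cases hg : Nat.gcd n ((p ^ (4 * (1 + 1 * j)) - 1) / 3) = 1
  · have h1 := h.count_le hn hg
    rw [trace_of_four_mul hp hp2 h] at h1
    push_cast at h1
    nlinarith
  · rw [h.count_eq_zero n hg, Nat.cast_zero]
    nlinarith

theorem count_bounds (hn : 0 < n)
    (ht : ∀ k, 0 < k → p ^ k ≡ 1 [MOD 3] → IsCubicTrace (F k) p (p ^ k) (t k))
    {k : ℕ} (h : Admissible p n k) :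
    (2 * (p : ℝ) ^ k - 4 * √((p : ℝ) ^ k) - 16) / 9 ≤ permBinomialCount (F k) n ∧
      (permBinomialCount (F k) n : ℝ) ≤ (2 * (p : ℝ) ^ k + 4 * √((p : ℝ) ^ k) - 7) / 9 := by
  have hk := ht k h.1 h.2.1
  have h1 := hk.count_le hn h.2.2
  have h2 := hk.le_count hn h.2.2
  have h3 := abs_le.1 hk.abs_le
  push_cast at h1 h2 h3
  constructor <;> linarith

end

theorem corollary4p6
    (p n : ℕ) (hp : p.Prime) (hn : 0 < n)
    -- `F k` is a field with `p ^ k` elements, for each positive `k`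
    (F : ℕ → Type*) [∀ k, Field (F k)] (hF : ∀ k, 0 < k → Nat.card (F k) = p ^ k) :
    -- the two-sided bound for `T_k`
    (∀ k : ℕ, Admissible p n k →
      ⌈(2 * (p : ℝ) ^ k - 4 * √((p : ℝ) ^ k) - 16) / 9⌉ ≤ (permBinomialCount (F k) n : ℤ) ∧
      (permBinomialCount (F k) n : ℤ) ≤ ⌊(2 * (p : ℝ) ^ k + 4 * √((p : ℝ) ^ k) - 7) / 9⌋) ∧
    -- asymptotic sharpness
    ((∃ k₀, Admissible p n k₀) → ∀ ε : ℝ, 0 < ε →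
      -- the upper bound is sharp along `k'` satisfying all the assumptions
      {k' : ℕ | Admissible p n k' ∧
        (permBinomialCount (F k') n : ℝ) >
          2 / 9 * (p : ℝ) ^ k' + (4 / 9 - ε) * √((p : ℝ) ^ k')}.Infinite ∧
      -- the lower inequality holds for infinitely many `k` with `p ^ k ≡ 1 (mod 3)`
      {k : ℕ | 0 < k ∧ p ^ k ≡ 1 [MOD 3] ∧
        (permBinomialCount (F k) n : ℝ) <
          2 / 9 * (p : ℝ) ^ k - (4 / 9 - ε) * √((p : ℝ) ^ k)}.Infinite ∧
      -- and these `k` can be taken to satisfy all the assumptions, unless `p ≡ 2 (mod 3)` and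
      -- no multiple of `4` satisfies them
      ((p ≡ 1 [MOD 3] ∨ ∃ k₀, Admissible p n k₀ ∧ 4 ∣ k₀) →
        {k : ℕ | Admissible p n k ∧
          (permBinomialCount (F k) n : ℝ) <
            2 / 9 * (p : ℝ) ^ k - (4 / 9 - ε) * √((p : ℝ) ^ k)}.Infinite)) ∧
    -- the Masuda-Zieve constant for `r = 3` is 20, and it can be replaced by 2
    (masudaZieveConst 3 = 20 ∧
      ∀ k : ℕ, Admissible p n k → MasudaZieveEstimate 3 (p ^ k) 2 (permBinomialCount (F k) n)) := by
  obtain ⟨t, ht⟩ := exists_trace_family hp hF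
  refine ⟨fun k hk => ?_, ?_, by norm_num [masudaZieveConst], fun k hk => ?_⟩
  · obtain ⟨h1, h2⟩ := count_bounds hn ht hk
    exact ⟨Int.ceil_le.2 (by exact_mod_cast h1), Int.le_floor.2 (by exact_mod_cast h2)⟩
  · rintro ⟨k₀, h₀⟩ ε hε
    refine ⟨infinite_count_gt hp hn ht h₀ hε, ?_, ?_⟩
    · rcases mod_three_of_pow h₀.1 h₀.2.1 with hp1 | ⟨hp2, -⟩
      · exact (infinite_count_lt hp hn ht h₀ (Or.inl hp1) hε).mono
          fun k hk => ⟨hk.1.1, hk.1.2.1, hk.2⟩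
      · exact infinite_count_lt_of_inert hp hn ht hp2 hε
    · rintro (hp1 | ⟨k₁, h₁, h4⟩)
      · exact infinite_count_lt hp hn ht h₀ (Or.inl hp1) hε
      · exact infinite_count_lt hp hn ht h₁ (Or.inr h4) hε
  -- In ninths, the constants to compare are -7 ≤ 2 above and -70 = 2 - 72 ≤ -16 below.
  · obtain ⟨h1, h2⟩ := count_bounds hn ht hk
    have h3 : 0 ≤ √((p : ℝ) ^ k) := Real.sqrt_nonneg _
    rw [MasudaZieveEstimate]
    norm_num [Nat.factorial]
    constructor <;> linarith
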